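/- Let $X$ be a finite non-empty set and let $r\colon X\times X\to X\times X$, $r(x,y)=(\lambda_x(y),\rho_y(x))$, be a bijective non-degenerate solution of the Yang--Baxter equation, i.e. $r$ is bijective, all maps $\lambda_x,\rho_y\colon X\to X$ are bijective, and $(r\times\mathrm{id})(\mathrm{id}\times r)(r\times\mathrm{id})=(\mathrm{id}\times r)(r\times\mathrm{id})(\mathrm{id}\times r)$. For $x,y\in X$ put $\sigma_y(x)=\lambda_y\rho_{\lambda_x^{-1}(y)}(x)$, let $$A(X,r)=\langle\, x\in X \mid x+y=y+\sigma_y(x)\ \text{ for all } x,y\in X\,\rangle$$ be the derived structure group (written additively, not necessarily abelian), and let $q\colon X\to X$, $q(x)=\lambda_x^{-1}(x)$, be the diagonal permutation, whose order in the symmetric group of $X$ is denoted by $|q|$. If $A(X,r)$ is nilpotent and not isomorphic to $\mathbb{Z}$, and $\gcd(|X|,|q|)=1$, then $(X,r)$ is decomposable: there is a partition $X=Y\sqcup Z$ with $Y,Z\neq\emptyset$ such that $r(Y\times Y)\subseteq Y\times Y$ and $r(Z\times Z)\subseteq Z\times Z$. -/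

import Mathlib

/-- A bijective non-degenerate set-theoretic solution of the Yang--Baxter equation on `X`:
`r (x, y) = (lam x y, rho y x)`, where `r` is bijective, every `lam x` and every `rho y` is
bijective, and the braid relation holds on `X × X × X`. -/
structure YBSolution (X : Type*) where
  /-- The map `r`. -/
  r : X × X → X × X
  bijective : Function.Bijective r
  left_nondegenerate : ∀ x : X, Function.Bijective fun y => (r (x, y)).1
  right_nondegenerate : ∀ y : X, Function.Bijective fun x => (r (x, y)).2
  /-- `(r × id) (id × r) (r × id) = (id × r) (r × id) (id × r)`. -/
  braid :
    let r₁₂ : X × X × X → X × X × X := fun t =>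
      ((r (t.1, t.2.1)).1, (r (t.1, t.2.1)).2, t.2.2)
    let r₂₃ : X × X × X → X × X × X := fun t => (t.1, r t.2)
    r₁₂ ∘ r₂₃ ∘ r₁₂ = r₂₃ ∘ r₁₂ ∘ r₂₃

namespace YBSolution

/-- The permutation `lam x` of `X`, where `r (x, y) = (lam x y, rho y x)`. -/
noncomputable def lam {X : Type*} (S : YBSolution X) (x : X) : Equiv.Perm X :=
  Equiv.ofBijective (fun y => (S.r (x, y)).1) (S.left_nondegenerate x)

/-- The permutation `rho y` of `X`, where `r (x, y) = (lam x y, rho y x)`. -/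
noncomputable def rho {X : Type*} (S : YBSolution X) (y : X) : Equiv.Perm X :=
  Equiv.ofBijective (fun x => (S.r (x, y)).2) (S.right_nondegenerate y)

/-- The operation of the (left) derived rack: `sigma y x = x ◁ y = lam y (rho (lam x ⁻¹ y) x)`. -/
noncomputable def sigma {X : Type*} (S : YBSolution X) (y x : X) : X :=
  S.lam y (S.rho ((S.lam x).symm y) x)

/-- The relators `(x + y) - (y + sigma y x)` of the derived structure group, written
multiplicatively. -/
def derivedRels {X : Type*} (S : YBSolution X) : Set (FreeGroup X) :=
  {w | ∃ x y : X, w = (FreeGroup.of x * FreeGroup.of y) *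
    (FreeGroup.of y * FreeGroup.of (S.sigma y x))⁻¹}

/-- The derived structure group `A(X, r) = ⟨x ∈ X | x + y = y + sigma y x⟩`, written
multiplicatively. -/
abbrev DerivedGroup {X : Type*} (S : YBSolution X) : Type _ :=
  PresentedGroup S.derivedRels

/-- The (left) diagonal map `q x = lam x ⁻¹ x`, as an element of the monoid of self-maps of `X`
under composition. On a finite `X` it is a permutation; `orderOf S.diagonal` is the least `k ≥ 1`
such that the `k`-fold composite of `q` is the identity. -/
noncomputable def diagonal {X : Type*} (S : YBSolution X) : Function.End X :=
  fun x => (S.lam x).symm x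

/-- `(X, r)` is decomposable: `X` is the disjoint union of non-empty subsets `Y` and `Z` with
`r (Y × Y) ⊆ Y × Y` and `r (Z × Z) ⊆ Z × Z`. -/
def IsDecomposable {X : Type*} (S : YBSolution X) : Prop :=
  ∃ Y Z : Set X, Y.Nonempty ∧ Z.Nonempty ∧ Disjoint Y Z ∧ Y ∪ Z = Set.univ ∧
    Set.MapsTo S.r (Y ×ˢ Y) (Y ×ˢ Y) ∧ Set.MapsTo S.r (Z ×ˢ Z) (Z ×ˢ Z)

end YBSolution

/-! Let A be the derived group, written multiplicatively, and k = |q|. Every `lam x` is an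
automorphism of the derived rack, and x ↦ `lam x` extends to a map `act` on A with act(d ·
act(d)(e)) = act(d) act(e). It satisfies act(x^k)⁻¹ x = q^k(x), so act(x^k) fixes x (`act_gen_pow`).
Dividing A by a central subgroup that acts trivially gives a finite nilpotent group Ā, and the graph
of the induced map is a finite group G with a bijective cocycle G → Ā, i.e. a finite skew brace of
nilpotent type.

G is solvable: cocycle preimages of the Hall subgroups of Ā form a nested family of Hall subgroups
of G, and Burnside's two-prime theorem combined with Wielandt's three-subgroup theorem applies.
Hence Γ = Ā ⋊ G is solvable.

If the solution is indecomposable, the group generated by all `lam x` and `sigma y` is transitive on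
X, so Γ is transitive on the image X̄ of X in Ā, and |X̄| divides |X|. If |X̄| > 1, solvability puts
a point stabilizer inside a proper subgroup K of index p^m; p divides |X|, hence not k. A Sylow
p-subgroup Q of Γ, made of the p-parts of Ā and G, satisfies QK = Γ, so K ∩ Q lies in a maximal,
hence normal, subgroup M of Q, and M contains the stabilizer in Q of every point of X̄. But Q is
generated by elements fixing some point, built from powers y^(kq') with q' the part of |Ā| prime to
p. This contradiction (`subsingleton_of_bijective_cocycle`) shows that X̄ is a point.

Then all `lam x` equal one permutation q⁻¹ and the generators of A commute. Their set is one orbit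
of a cyclic group of order dividing k, and its size also divides |X|; so there is one generator and
A ≅ ℤ. -/

/-! ### Averages of roots of unity and matrices of finite order. -/

/-- Equality case of the triangle inequality: the numbers 1 - Re(z ā) are nonnegative and sum to
zero. -/
lemma Multiset.eq_of_norm_sum_eq_card {s : Multiset ℂ} (hs : ∀ z ∈ s, ‖z‖ = 1) {a : ℂ}
    (ha : ‖a‖ = 1) (hsum : s.sum = s.card * a) : ∀ z ∈ s, z = a := by
  have key : ∀ z ∈ s, (z * (starRingEnd ℂ) a).re ≤ 1 := fun z hz => by
    refine (Complex.re_le_norm _).trans ?_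
    simp [hs z hz, ha]
  have haa : a * (starRingEnd ℂ) a = 1 := by
    rw [Complex.mul_conj, Complex.normSq_eq_norm_sq, ha]; simp
  have hre : (s.map fun z => 1 - (z * (starRingEnd ℂ) a).re).sum = 0 := by
    have h1 : (s.map fun z => (z * (starRingEnd ℂ) a).re).sum = s.card := by
      have : (s.map fun z => (z * (starRingEnd ℂ) a).re).sum
          = (s.sum * (starRingEnd ℂ) a).re := by
        have h := map_multiset_sum
          (Complex.reAddGroupHom.comp (AddMonoidHom.mulRight ((starRingEnd ℂ) a))) s
        exact h.symm
      rw [this, hsum, mul_assoc, haa]; simp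
    rw [Multiset.sum_map_sub, h1]; simp
  intro z hz
  have hnn : ∀ x ∈ s.map (fun z => 1 - (z * (starRingEnd ℂ) a).re), 0 ≤ x := by
    intro x hx
    obtain ⟨w, hw, rfl⟩ := Multiset.mem_map.1 hx
    linarith [key w hw]
  have hz1 : (z * (starRingEnd ℂ) a).re = 1 := by
    have := Multiset.all_zero_of_le_zero_le_of_sum_eq_zero hnn hre _
      (Multiset.mem_map_of_mem (fun z => 1 - (z * (starRingEnd ℂ) a).re) hz)
    linarith
  have hn : ‖z * (starRingEnd ℂ) a‖ = 1 := by simp [hs z hz, ha]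
  have hz2 : z * (starRingEnd ℂ) a = 1 := by
    have h3 := Complex.normSq_eq_norm_sq (z * (starRingEnd ℂ) a)
    rw [hn, Complex.normSq_apply, hz1] at h3
    apply Complex.ext
    · simpa using hz1
    · have : (z * (starRingEnd ℂ) a).im * (z * (starRingEnd ℂ) a).im = 0 := by linarith
      simpa using this
  calc z = z * (a * (starRingEnd ℂ) a) := by rw [haa, mul_one]
    _ = a * (z * (starRingEnd ℂ) a) := by ring
    _ = a := by rw [hz2, mul_one]

/-- If the average of finitely many roots of unity is a nonzero algebraic integer, then the roots
of unity all coincide with their average. -/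
lemma Multiset.eq_of_isIntegral_average {s : Multiset ℂ} {N : ℕ} (hN : 0 < N)
    (hs : ∀ z ∈ s, z ^ N = 1) {a : ℂ} (ha : a ≠ 0) (hint : IsIntegral ℤ a)
    (hsum : s.sum = s.card * a) : ∀ z ∈ s, z = a := by
  classical
  rcases Multiset.empty_or_exists_mem s with rfl | ⟨z₀, hz₀⟩
  · simp
  have hcard : (s.card : ℂ) ≠ 0 := by
    simpa using (Multiset.card_pos_iff_exists_mem.2 ⟨z₀, hz₀⟩).ne'
  let K := IntermediateField.adjoin ℚ (s.toFinset : Set ℂ)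
  have : FiniteDimensional ℚ K := by
    have : Finite (s.toFinset : Set ℂ) := by infer_instance
    refine IntermediateField.finiteDimensional_adjoin fun z hz => ?_
    exact (IsIntegral.of_pow hN (by rw [hs z (by simpa using hz)]; exact isIntegral_one))
  have : NumberField K := ⟨⟩
  obtain ⟨t, hts⟩ : ∃ t : Multiset K, t.map (algebraMap K ℂ) = s := by
    have : ∀ z ∈ s, ∃ y : K, algebraMap K ℂ y = z := fun z hz =>
      ⟨⟨z, IntermediateField.subset_adjoin ℚ _ (by simpa using hz)⟩, rfl⟩
    choose f hf using this
    exact ⟨s.pmap (fun z hz => f z hz) (fun _ h => h), by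
      rw [Multiset.map_pmap]; simp [hf, Multiset.pmap_eq_map]⟩
  clear_value K
  subst hts
  have hpow : ∀ y ∈ t, y ^ N = 1 := fun y hy => by
    apply (algebraMap K ℂ).injective
    rw [map_pow, map_one]
    exact hs _ (Multiset.mem_map_of_mem _ hy)
  have ht : (t.card : K) ≠ 0 := by
    intro h; apply hcard; rw [Multiset.card_map]
    have := congrArg (algebraMap K ℂ) h
    simpa using this
  set b : K := t.sum / t.card with hb
  have hba : algebraMap K ℂ b = a := by
    rw [hb, map_div₀, map_natCast, map_multiset_sum, hsum, Multiset.card_map]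
    rw [Multiset.card_map] at hcard
    field_simp
  have hbint : IsIntegral ℤ b := by
    rw [← hba] at hint
    exact (isIntegral_algebraMap_iff (algebraMap K ℂ).injective).1 hint
  have hb0 : b ≠ 0 := by rintro h; apply ha; rw [← hba, h]; exact (algebraMap K ℂ).map_zero
  -- Kronecker's theorem: every conjugate of b is again an average of roots of unity, so has
  -- absolute value at most 1; hence b is a root of unity.
  obtain ⟨m, hm, hbm⟩ := NumberField.Embeddings.pow_eq_one_of_norm_le_one K ℂ hb0 hbint (by
    intro φ
    have hc : ((t.card : ℕ) : ℝ) ≠ 0 := by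
      intro h; apply ht; exact_mod_cast h
    rw [hb, map_div₀, map_natCast, map_multiset_sum, norm_div, Complex.norm_natCast]
    refine div_le_one_of_le₀ ?_ (Nat.cast_nonneg _)
    refine (norm_multiset_sum_le _).trans ?_
    rw [Multiset.map_map]
    refine (Multiset.sum_le_card_nsmul _ (1 : ℝ) ?_).trans (by simp)
    intro x hx
    obtain ⟨y, hy, rfl⟩ := Multiset.mem_map.1 hx
    have : (φ y) ^ N = 1 := by rw [← map_pow, hpow y hy, map_one]
    exact (Complex.norm_eq_one_of_pow_eq_one this hN.ne').le)
  refine Multiset.eq_of_norm_sum_eq_card (fun z hz => Complex.norm_eq_one_of_pow_eq_one (hs z hz) hN.ne')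
    ?_ hsum
  refine Complex.norm_eq_one_of_pow_eq_one (n := m) ?_ hm.ne'
  rw [← hba, ← map_pow, hbm, map_one]

lemma Matrix.trace_isIntegral_of_pow_eq_one {n : Type*} [Fintype n] [DecidableEq n] [Nonempty n]
    {M : Matrix n n ℂ} {N : ℕ} (hN : 0 < N) (hM : M ^ N = 1) : IsIntegral ℤ M.trace ∧
    ∀ z ∈ M.charpoly.roots, z ^ N = 1 := by
  have hroots : ∀ z ∈ M.charpoly.roots, z ^ N = 1 := by
    intro z hz
    have h1 : z ∈ spectrum ℂ M := by
      rw [Matrix.mem_spectrum_iff_isRoot_charpoly]; exact Polynomial.isRoot_of_mem_roots hz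
    have h2 := spectrum.pow_mem_pow M N h1
    rw [hM] at h2
    simpa using h2
  refine ⟨?_, hroots⟩
  rw [Matrix.trace_eq_sum_roots_charpoly]
  exact IsIntegral.multiset_sum fun z hz =>
    IsIntegral.of_pow hN (by rw [hroots z hz]; exact isIntegral_one)

/-- A matrix of finite order whose normalised trace is a nonzero algebraic integer is scalar. -/
lemma Matrix.eq_scalar_of_isIntegral_trace {n : Type*} [Fintype n] [DecidableEq n] [Nonempty n]
    {M : Matrix n n ℂ} {N : ℕ} (hN : 0 < N) (hM : M ^ N = 1) {a : ℂ} (ha : a ≠ 0)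
    (hint : IsIntegral ℤ a) (htr : M.trace = Fintype.card n * a) : M = algebraMap ℂ _ a := by
  classical
  obtain ⟨-, hroots⟩ := Matrix.trace_isIntegral_of_pow_eq_one hN hM
  have hcard : M.charpoly.roots.card = Fintype.card n := by
    rw [← M.charpoly_natDegree_eq_dim]
    exact (Polynomial.splits_iff_card_roots.1 (IsAlgClosed.splits _))
  have hall : ∀ z ∈ M.charpoly.roots, z = a :=
    Multiset.eq_of_isIntegral_average hN hroots ha hint (by
      rw [← Matrix.trace_eq_sum_roots_charpoly, htr, hcard])
  -- M is diagonalizable because its minimal polynomial divides the separable X^N - 1; with a single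
  -- eigenvalue it must be scalar.
  have hsq : Squarefree (minpoly ℂ M) := by
    have hsep : (Polynomial.X ^ N - 1 : Polynomial ℂ).Separable :=
      Polynomial.separable_X_pow_sub_C (1 : ℂ) (by exact_mod_cast hN.ne') one_ne_zero
    refine hsep.squarefree.squarefree_of_dvd (minpoly.dvd _ _ ?_)
    simp [hM]
  have hdvd : minpoly ℂ M ∣ (Polynomial.X - Polynomial.C a) ^ Fintype.card n := by
    have h := Matrix.minpoly_dvd_charpoly M
    have h2 := (IsAlgClosed.splits M.charpoly).eq_prod_roots_of_monic M.charpoly_monic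
    rw [Multiset.eq_replicate.2 ⟨hcard, hall⟩] at h2
    rw [h2] at h
    simpa using h
  have h3 : minpoly ℂ M ∣ Polynomial.X - Polynomial.C a :=
    (hsq.dvd_pow_iff_dvd Fintype.card_ne_zero).1 hdvd
  have h4 := (minpoly.dvd_iff (A := ℂ) (x := M)).1 h3
  simpa [sub_eq_zero] using h4

/-! ### Complex group algebras and Burnside's two-prime theorem. -/

open scoped MonoidAlgebra in
lemma MonoidAlgebra.trace_mulLeft {G : Type*} [Group G] [Finite G] (x : ℂ[G]) :
    LinearMap.trace ℂ ℂ[G] (LinearMap.mulLeft ℂ x) = Nat.card G * x.coeff 1 := by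
  classical
  have := Fintype.ofFinite G
  rw [LinearMap.trace_eq_matrix_trace ℂ (MonoidAlgebra.basis G ℂ), Matrix.trace]
  have : ∀ g : G, (LinearMap.toMatrix (MonoidAlgebra.basis G ℂ) (MonoidAlgebra.basis G ℂ)
      (LinearMap.mulLeft ℂ x)).diag g = x.coeff 1 := by
    intro g
    rw [Matrix.diag_apply, LinearMap.toMatrix_apply, MonoidAlgebra.basis_apply]
    change (x * MonoidAlgebra.single g 1).coeff g = _
    simp [MonoidAlgebra.coeff_mul_single_apply]
  rw [Fintype.sum_congr _ _ this]
  simp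

lemma Matrix.trace_mulLeft_pi {n : ℕ} {d : Fin n → ℕ}
    (M : Π i, Matrix (Fin (d i)) (Fin (d i)) ℂ) :
    LinearMap.trace ℂ _ (LinearMap.mulLeft ℂ M) = ∑ i, (d i : ℂ) * (M i).trace := by
  classical
  let b := Pi.basis fun i => Matrix.stdBasis ℂ (Fin (d i)) (Fin (d i))
  rw [LinearMap.trace_eq_matrix_trace ℂ b, Matrix.trace]
  have : ∀ j : (Σ i, Fin (d i) × Fin (d i)), (LinearMap.toMatrix b b
      (LinearMap.mulLeft ℂ M)).diag j = M j.1 j.2.1 j.2.1 := by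
    rintro ⟨i, k, l⟩
    rw [Matrix.diag_apply, LinearMap.toMatrix_apply]
    simp only [b, Pi.basis_apply, Pi.basis_repr, LinearMap.mulLeft_apply, Pi.mul_apply,
      Pi.single_eq_same]
    rw [Matrix.stdBasis_eq_single]
    simp [Matrix.stdBasis, Matrix.mul_apply, Matrix.single_apply]
  rw [Fintype.sum_congr _ _ this, Fintype.sum_sigma]
  refine Fintype.sum_congr _ _ fun i => ?_
  rw [Fintype.sum_prod_type, Matrix.trace, Finset.mul_sum]
  simp

lemma Complex.not_isIntegral_neg_one_div_prime {p : ℕ} (hp : p.Prime) :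
    ¬ IsIntegral ℤ (-1 / p : ℂ) := by
  intro h
  have h1 : IsIntegral ℤ (algebraMap ℚ ℂ (-1 / p)) := by simpa using h
  rw [isIntegral_algebraMap_iff (algebraMap ℚ ℂ).injective] at h1
  obtain ⟨m, hm⟩ := (IsIntegrallyClosed.isIntegral_iff (R := ℤ) (K := ℚ)).1 h1
  have hp0 : (p : ℚ) ≠ 0 := by exact_mod_cast hp.ne_zero
  have h2 : (m : ℚ) * p = -1 := by
    rw [← eq_intCast (algebraMap ℤ ℚ), hm]; field_simp
  have h3 : m * p = -1 := by exact_mod_cast h2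
  have h4 : (p : ℤ) ∣ 1 := ⟨-m, by linarith⟩
  exact hp.one_lt.ne' (by exact_mod_cast Int.eq_one_of_dvd_one (by positivity) h4)

/-- For `g ≠ 1` in a finite group and a prime `p` there is a nontrivial irreducible complex
representation of degree prime to `p` whose character does not vanish at `g`. -/
theorem exists_irreducible_trace_ne_zero {G : Type*} [Group G] [Finite G] {g : G} (hg : g ≠ 1)
    {p : ℕ} (hp : p.Prime) :
    ∃ (d : ℕ) (_ : NeZero d) (ρ : G →* Matrix (Fin d) (Fin d) ℂ),
      Function.Surjective (MonoidAlgebra.lift ℂ _ G ρ) ∧ (∃ h, ρ h ≠ 1) ∧ ¬ p ∣ d ∧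
      (ρ g).trace ≠ 0 := by
  classical
  have := Fintype.ofFinite G
  obtain ⟨n, d, hd, ⟨e⟩⟩ := IsSemisimpleRing.exists_algEquiv_pi_matrix_of_isAlgClosed ℂ
    (MonoidAlgebra ℂ G)
  let ψ : ∀ i, MonoidAlgebra ℂ G →ₐ[ℂ] Matrix (Fin (d i)) (Fin (d i)) ℂ := fun i =>
    (Pi.evalAlgHom ℂ (fun i => Matrix (Fin (d i)) (Fin (d i)) ℂ) i).comp e.toAlgHom
  let ρ : ∀ i, G →* Matrix (Fin (d i)) (Fin (d i)) ℂ := fun i =>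
    (MonoidAlgebra.lift ℂ _ G).symm (ψ i)
  have hψ : ∀ i, Function.Surjective (ψ i) := fun i =>
    (Function.surjective_eval i).comp e.surjective
  have hρ : ∀ i, MonoidAlgebra.lift ℂ _ G (ρ i) = ψ i := fun i => Equiv.apply_symm_apply _ _
  by_contra! hcon
  -- `c • s` is the averaging idempotent. Multiplying by `1 - c • s` removes the trivial blocks, so
  -- column orthogonality can be used without counting them.
  let s : MonoidAlgebra ℂ G := ∑ h : G, MonoidAlgebra.of ℂ G h
  let c : ℂ := (Nat.card G : ℂ)⁻¹
  have hcard : (Nat.card G : ℂ) ≠ 0 := by exact_mod_cast Nat.card_pos.ne'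
  have hs : ∀ h, MonoidAlgebra.of ℂ G h * s = s := fun h => by
    simp only [s, Finset.mul_sum, ← map_mul]
    exact Fintype.sum_equiv (Equiv.mulLeft h) _ _ fun _ => rfl
  have hs' : ∀ h, s * MonoidAlgebra.of ℂ G h = s := fun h => by
    simp only [s, Finset.sum_mul, ← map_mul]
    exact Fintype.sum_equiv (Equiv.mulRight h) _ _ fun _ => rfl
  have hscomm : ∀ x, s * x = x * s := fun x => by
    induction x using MonoidAlgebra.induction_on with
    | of h => rw [hs, hs']
    | add x y hx hy => rw [mul_add, add_mul, hx, hy]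
    | smul r x hx => rw [mul_smul_comm, smul_mul_assoc, hx]
  have hterm : ∀ i, ∃ z : ℂ, IsIntegral ℤ z ∧
      (d i : ℂ) * (ψ i (MonoidAlgebra.of ℂ G g * (1 - c • s))).trace = p * z := by
    intro i
    have := hd i
    have hof : ∀ h, ψ i (MonoidAlgebra.of ℂ G h) = ρ i h := fun h => rfl
    have hexp : ψ i (MonoidAlgebra.of ℂ G g * (1 - c • s)) = ρ i g - c • ψ i s := by
      rw [mul_sub, mul_one, mul_smul_comm, hs, map_sub, map_smul, hof]
    rw [hexp]
    by_cases htriv : ∀ h, ρ i h = 1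
    · refine ⟨0, isIntegral_zero, ?_⟩
      have : ψ i s = (Nat.card G : ℂ) • 1 := by
        simp only [s, map_sum, hof, htriv]
        simp [Nat.cast_smul_eq_nsmul]
      rw [this, htriv, smul_smul, inv_mul_cancel₀ hcard]
      simp
    · push Not at htriv
      have hps : ψ i s = 0 := by
        have hcent : ψ i s ∈ Set.center (Matrix (Fin (d i)) (Fin (d i)) ℂ) := by
          rw [Semigroup.mem_center_iff]
          intro y
          obtain ⟨x, rfl⟩ := hψ i y
          rw [← map_mul, ← map_mul, hscomm]
        rw [Matrix.center_eq_range] at hcent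
        obtain ⟨t, ht⟩ := hcent
        obtain ⟨h, hh⟩ := htriv
        have h1 : ρ i h * ψ i s = ψ i s := by rw [← hof, ← map_mul, hs]
        rw [← ht] at h1 ⊢
        by_cases ht0 : t = 0
        · simp [ht0]
        · exfalso; apply hh
          have h2 : Matrix.scalar (Fin (d i)) t * Matrix.scalar (Fin (d i)) t⁻¹ = 1 := by
            rw [← map_mul, mul_inv_cancel₀ ht0, map_one]
          calc ρ i h = ρ i h * Matrix.scalar (Fin (d i)) t * Matrix.scalar (Fin (d i)) t⁻¹ := by
                rw [mul_assoc, h2, mul_one]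
            _ = 1 := by rw [h1, h2]
      rw [hps, smul_zero, sub_zero]
      by_cases hpd : p ∣ d i
      · obtain ⟨k, hk⟩ := hpd
        refine ⟨k * (ρ i g).trace, ?_, by
          rw [show (d i : ℂ) = p * k by exact_mod_cast hk, mul_assoc]⟩
        refine (isIntegral_algebraMap (R := ℤ) (x := (k : ℤ))).mul ?_
        refine (Matrix.trace_isIntegral_of_pow_eq_one (N := Nat.card G) Nat.card_pos ?_).1
        rw [← map_pow, pow_card_eq_one', map_one]
      · refine ⟨0, isIntegral_zero, ?_⟩
        rw [hcon (d i) (hd i) (ρ i) (by rw [hρ]; exact hψ i) htriv hpd]; simp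
  choose z hz hz' using hterm
  have htr : LinearMap.trace ℂ _ (LinearMap.mulLeft ℂ (MonoidAlgebra.of ℂ G g * (1 - c • s)))
      = ∑ i, (d i : ℂ) * (ψ i (MonoidAlgebra.of ℂ G g * (1 - c • s))).trace := by
    rw [← LinearMap.trace_conj' _ e.toLinearEquiv]
    rw [← Matrix.trace_mulLeft_pi fun i => ψ i (MonoidAlgebra.of ℂ G g * (1 - c • s))]
    refine congrArg _ (LinearMap.ext fun x => ?_)
    change e (_ * e.symm x) = _
    rw [map_mul, e.apply_symm_apply]
    rfl
  -- Since g ≠ 1, only `c • s` contributes at the identity. The same trace, computed blockwise, is p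
  -- times an algebraic integer, which makes -1/p integral.
  have hval : (Nat.card G : ℂ) * (MonoidAlgebra.of ℂ G g * (1 - c • s)).coeff 1 = -1 := by
    have hs1 : s.coeff 1 = 1 := by
      simp [s]
    have hg1 : (MonoidAlgebra.of ℂ G g).coeff 1 = 0 := by
      simp [MonoidAlgebra.of_apply, hg]
    rw [mul_sub, mul_one, mul_smul_comm, hs, MonoidAlgebra.coeff_sub, Finsupp.sub_apply,
      MonoidAlgebra.coeff_smul, Finsupp.smul_apply, hs1, hg1]
    simp [c]
  rw [MonoidAlgebra.trace_mulLeft, hval] at htr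
  simp only [hz', ← Finset.mul_sum] at htr
  apply Complex.not_isIntegral_neg_one_div_prime hp
  rw [htr, mul_div_cancel_left₀ _ (by exact_mod_cast hp.ne_zero)]
  exact IsIntegral.sum _ fun i _ => hz i

/-- A finite simple group in which a nontrivial element has a conjugacy class of prime power
size is commutative. -/
theorem IsSimpleGroup.mul_comm_of_index_centralizer_eq_prime_pow {G : Type*} [Group G] [Finite G]
    [IsSimpleGroup G] {g : G} (hg : g ≠ 1) {p k : ℕ} (hp : p.Prime)
    (hgk : (Subgroup.centralizer ({g} : Set G)).index = p ^ k) (a b : G) : a * b = b * a := by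
  classical
  have := Fintype.ofFinite G
  obtain ⟨d, hd, ρ, hsurj, ⟨h₀, hh₀⟩, hpd, htr⟩ := exists_irreducible_trace_ne_zero hg hp
  have hN : ∀ x : G, ρ x ^ Nat.card G = 1 := fun x => by
    rw [← map_pow, pow_card_eq_one', map_one]
  set C : Finset G := (MulAction.orbit (ConjAct G) g).toFinset with hC
  have hCcard : C.card = p ^ k := by
    rw [hC, ← Set.ncard_eq_toFinset_card', ← MulAction.index_stabilizer,
      ConjAct.stabilizer_eq_centralizer, ← hgk]
    rfl
  have hCmem : ∀ x, x ∈ C ↔ ∃ h : G, h * g * h⁻¹ = x := fun x => by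
    rw [hC, Set.mem_toFinset, MulAction.mem_orbit_iff]
    exact ⟨fun ⟨h, e⟩ => ⟨ConjAct.ofConjAct h, by rw [← e]; rfl⟩,
      fun ⟨h, e⟩ => ⟨ConjAct.toConjAct h, by rw [← e]; rfl⟩⟩
  let zZ : MonoidAlgebra ℤ G := ∑ c ∈ C, MonoidAlgebra.of ℤ G c
  let Z : Matrix (Fin d) (Fin d) ℂ := ∑ c ∈ C, ρ c
  have hZ : MonoidAlgebra.lift ℤ (Matrix (Fin d) (Fin d) ℂ) G ρ zZ = Z := by
    simp [zZ, Z, map_sum]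
  have hZint : IsIntegral ℤ Z := by
    rw [← hZ]
    exact (Algebra.IsIntegral.isIntegral zZ).map _
  have hZconj : ∀ h, ρ h * Z = Z * ρ h := by
    intro h
    simp only [Z, Finset.mul_sum, Finset.sum_mul, ← map_mul]
    refine Finset.sum_bij (fun c _ => h * c * h⁻¹) ?_ ?_ ?_ ?_
    · intro c hc
      obtain ⟨y, rfl⟩ := (hCmem c).1 hc
      exact (hCmem _).2 ⟨h * y, by group⟩
    · intro c _ c' _ e
      simpa using e
    · intro c hc
      obtain ⟨y, rfl⟩ := (hCmem c).1 hc
      exact ⟨h⁻¹ * (y * g * y⁻¹) * h, (hCmem _).2 ⟨h⁻¹ * y, by group⟩, by group⟩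
    · intro c _; simp
  have hZcomm : ∀ x, MonoidAlgebra.lift ℂ (Matrix (Fin d) (Fin d) ℂ) G ρ x * Z
      = Z * MonoidAlgebra.lift ℂ (Matrix (Fin d) (Fin d) ℂ) G ρ x := fun x => by
    induction x using MonoidAlgebra.induction_on with
    | of h => simpa using hZconj h
    | add x y hx hy => rw [map_add, mul_add, add_mul, hx, hy]
    | smul r x hx => rw [map_smul, mul_smul_comm, smul_mul_assoc, hx]
  have hZcent : Z ∈ Set.center (Matrix (Fin d) (Fin d) ℂ) := by
    rw [Semigroup.mem_center_iff]
    intro y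
    obtain ⟨x, rfl⟩ := hsurj y
    exact hZcomm x
  rw [Matrix.center_eq_range] at hZcent
  obtain ⟨w, hw⟩ := hZcent
  have hwint : IsIntegral ℤ w := by
    rw [← hw] at hZint
    refine (isIntegral_algebraMap_iff (A := ℂ) (B := Matrix (Fin d) (Fin d) ℂ)
      (algebraMap ℂ (Matrix (Fin d) (Fin d) ℂ)).injective).1 hZint
  have htrc : ∀ c ∈ C, (ρ c).trace = (ρ g).trace := by
    intro c hc
    obtain ⟨y, rfl⟩ := (hCmem c).1 hc
    rw [map_mul, Matrix.trace_mul_comm, ← map_mul]; simp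
  have hwd : (d : ℂ) * w = p ^ k * (ρ g).trace := by
    have h1 : Z.trace = (d : ℂ) * w := by rw [← hw]; simp [Matrix.trace]
    rw [← h1, Matrix.trace_sum, Finset.sum_congr rfl htrc, Finset.sum_const, hCcard]
    simp
  have hdne : (d : ℂ) ≠ 0 := by exact_mod_cast hd.out
  -- Both p^k χ(g)/d = w and χ(g) are integral; Bézout for p^k and d removes the factor p^k.
  have hint : IsIntegral ℤ ((ρ g).trace / d) := by
    have hcop : IsCoprime ((p : ℤ) ^ k) (d : ℤ) := by
      have := Nat.Coprime.pow_left k ((Nat.Prime.coprime_iff_not_dvd hp).2 hpd)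
      exact_mod_cast Nat.isCoprime_iff_coprime.2 this
    obtain ⟨u, v, huv⟩ := hcop
    have huv' : (u : ℂ) * p ^ k + v * d = 1 := by exact_mod_cast huv
    have : (ρ g).trace / d = u * w + v * (ρ g).trace := by
      have hw' : w = p ^ k * (ρ g).trace / d := by rw [← hwd]; field_simp
      rw [hw']; field_simp
      linear_combination -huv'
    rw [this]
    have htrint := (Matrix.trace_isIntegral_of_pow_eq_one Nat.card_pos (hN g)).1
    exact ((isIntegral_algebraMap (R := ℤ) (x := u)).mul hwint).add
      ((isIntegral_algebraMap (R := ℤ) (x := v)).mul htrint)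
  have hscal : ρ g = algebraMap ℂ _ ((ρ g).trace / d) :=
    Matrix.eq_scalar_of_isIntegral_trace Nat.card_pos (hN g) (div_ne_zero htr hdne) hint
      (by rw [Fintype.card_fin]; field_simp)
  -- The elements that become central in the image of ρ form a normal subgroup containing g, hence
  -- everything by simplicity. As ρ is faithful, G itself is commutative.
  let H : Subgroup G := (Subgroup.center (MonoidHom.range ρ.toHomUnits)).comap
    ρ.toHomUnits.rangeRestrict
  have hgH : g ∈ H := by
    rw [Subgroup.mem_comap, Subgroup.mem_center_iff]
    rintro ⟨_, y, rfl⟩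
    apply Subtype.ext; apply Units.ext
    change ρ y * ρ g = ρ g * ρ y
    rw [hscal]
    exact (Algebra.commutes _ _).symm
  have hHtop : H = ⊤ := (Subgroup.Normal.eq_bot_or_eq_top
    (inferInstance : H.Normal)).resolve_left fun h => hg (by rw [h] at hgH; simpa using hgH)
  have hker : ρ.toHomUnits.ker = ⊥ := by
    refine (Subgroup.Normal.eq_bot_or_eq_top (inferInstance : ρ.toHomUnits.ker.Normal)).resolve_right
      fun h => hh₀ ?_
    have : h₀ ∈ ρ.toHomUnits.ker := by rw [h]; trivial
    rw [MonoidHom.mem_ker] at this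
    exact congrArg Units.val this
  apply (MonoidHom.ker_eq_bot_iff _).1 hker
  have ha : a ∈ H := by rw [hHtop]; trivial
  rw [Subgroup.mem_comap, Subgroup.mem_center_iff] at ha
  have := ha (ρ.toHomUnits.rangeRestrict b)
  rw [← map_mul, ← map_mul] at this
  simpa using (congrArg Subtype.val this).symm

/-- **Burnside's theorem**: a group whose order has at most two prime factors is solvable. -/
theorem Group.isSolvable_of_card_eq_prime_pow_mul_prime_pow {p q : ℕ} (hp : p.Prime)
    (hq : q.Prime) (n : ℕ) : ∀ {G : Type*} [Group G] [Finite G], Nat.card G = n →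
      (∀ r : ℕ, r.Prime → r ∣ Nat.card G → r = p ∨ r = q) → Group.IsSolvable G := by
  induction n using Nat.strong_induction_on with
  | _ n ih =>
  intro G _ _ hn hG
  by_cases hsub : Subsingleton G
  · infer_instance
  rw [not_subsingleton_iff_nontrivial] at hsub
  by_cases hs : IsSimpleGroup G
  · obtain ⟨r, hr, hrG⟩ := Nat.exists_prime_and_dvd (Finite.one_lt_card (α := G)).ne'
    have := Fact.mk hr
    let P : Sylow r G := default
    have hPne : Nontrivial P := by
      rw [← Finite.one_lt_card_iff_nontrivial]
      refine hr.one_lt.trans_le (Nat.le_of_dvd Nat.card_pos (P.dvd_card_of_dvd_card hrG))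
    have := P.isPGroup'.center_nontrivial
    obtain ⟨z, hz⟩ := exists_ne (1 : Subgroup.center P)
    have hz1 : ((z : P) : G) ≠ 1 := fun h => hz (Subtype.ext (Subtype.ext h))
    have hPc : (P : Subgroup G) ≤ Subgroup.centralizer {((z : P) : G)} := by
      intro x hx
      rw [Subgroup.mem_centralizer_singleton_iff]
      have := Subgroup.mem_center_iff.1 z.2 ⟨x, hx⟩
      exact congrArg Subtype.val this
    -- The centralizer of a central element of a Sylow r-subgroup contains that subgroup, so only
    -- the other prime can divide the class size.
    have hidx : ¬ r ∣ (Subgroup.centralizer {((z : P) : G)}).index := fun h =>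
      P.not_dvd_index (h.trans (Subgroup.index_dvd_of_le hPc))
    set m := (Subgroup.centralizer {((z : P) : G)}).index with hm
    have hm0 : m ≠ 0 := Subgroup.index_ne_zero_of_finite
    have hmG : m ∣ Nat.card G := Subgroup.index_dvd_card _
    obtain ⟨s, k, hsp, hk⟩ : ∃ s k : ℕ, s.Prime ∧ m = s ^ k := by
      have hrpq := hG r hr hrG
      refine ⟨if r = p then q else p, _, by split_ifs <;> assumption,
        Nat.eq_prime_pow_of_unique_prime_dvd hm0 fun {t} ht htm => ?_⟩
      have htr : t ≠ r := by rintro rfl; exact hidx htm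
      rcases hG t ht (htm.trans hmG) with rfl | rfl <;> rcases hrpq with rfl | rfl <;> grind
    have hcomm := IsSimpleGroup.mul_comm_of_index_centralizer_eq_prime_pow hz1 hsp hk
    exact isSolvable_of_comm hcomm
  · have : ∃ N : Subgroup G, N.Normal ∧ N ≠ ⊥ ∧ N ≠ ⊤ := by
      by_contra! hcon
      exact hs ⟨fun N hN => or_iff_not_imp_left.2 (hcon N hN)⟩
    obtain ⟨N, hN, hb, ht⟩ := this
    have hmul := Subgroup.card_mul_index N
    have h1 : 1 < Nat.card N := by
      rw [Finite.one_lt_card_iff_nontrivial]; exact (Subgroup.nontrivial_iff_ne_bot N).2 hb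
    have h2 : N.index ≠ 1 := fun h => ht (Subgroup.index_eq_one.1 h)
    have h3 : N.index ≠ 0 := Subgroup.index_ne_zero_of_finite
    refine (isSolvable_iff_subgroup_quotient N).2
      ⟨ih (Nat.card N) ?_ rfl fun r hr h =>
        hG r hr (h.trans (Subgroup.card_subgroup_dvd_card N)),
      ih (Nat.card (G ⧸ N)) ?_ rfl fun r hr h =>
        hG r hr (h.trans (Subgroup.card_quotient_dvd_card N))⟩
    · rw [← hn, ← hmul]; nlinarith [show 2 ≤ N.index by omega]
    · change N.index < n
      rw [← hn, ← hmul]; nlinarith [show 2 ≤ N.index by omega]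

/-! ### Coprime indices, Wielandt's theorem and nested Hall subgroups. -/

/-- Subgroups of coprime index factorise the group. -/
lemma Subgroup.exists_mul_eq_of_coprime_index {G : Type*} [Group G] [Finite G] {H K : Subgroup G}
    (h : Nat.Coprime H.index K.index) (g : G) : ∃ x ∈ H, ∃ y ∈ K, x * y = g := by
  have h1 : (MulAction.orbit H (QuotientGroup.mk 1 : G ⧸ K)).ncard = K.index := by
    rw [← MulAction.index_stabilizer]
    have hst : MulAction.stabilizer H (QuotientGroup.mk 1 : G ⧸ K) = K.subgroupOf H := by
      ext x
      rw [MulAction.mem_stabilizer_iff, Subgroup.mem_subgroupOf]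
      change (QuotientGroup.mk ((x : G) * 1) : G ⧸ K) = _ ↔ _
      rw [mul_one, QuotientGroup.eq, mul_one, inv_mem_iff]
    rw [hst]
    change K.relIndex H = K.index
    have e1 : K.relIndex H * H.index = (K ⊓ H).index := by
      rw [← Subgroup.inf_relIndex_right, Subgroup.relIndex_mul_index inf_le_right]
    -- Coprimality forces the H-orbit of the base coset in G/K to be all of G/K.
    have e2 : K.index ∣ K.relIndex H := by
      refine (Nat.Coprime.dvd_of_dvd_mul_right h.symm ?_)
      rw [e1]
      exact Subgroup.index_dvd_of_le inf_le_left
    refine le_antisymm ?_ (Nat.le_of_dvd (Nat.pos_of_ne_zero ?_) e2)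
    · exact Subgroup.relIndex_le_of_le_right (K := H) (L := ⊤) le_top
        (by rw [Subgroup.relIndex_top_right]; exact Subgroup.index_ne_zero_of_finite)
        |>.trans_eq (Subgroup.relIndex_top_right _)
    · exact Subgroup.index_ne_zero_of_finite (H := K.subgroupOf H)
  have h2 : MulAction.orbit H (QuotientGroup.mk 1 : G ⧸ K) = Set.univ := by
    apply Set.eq_of_subset_of_ncard_le (Set.subset_univ _)
    rw [h1, Set.ncard_univ]; rfl
  have h3 : (QuotientGroup.mk g : G ⧸ K) ∈ MulAction.orbit H (QuotientGroup.mk 1 : G ⧸ K) := by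
    rw [h2]; trivial
  obtain ⟨x, hx⟩ := h3
  change (QuotientGroup.mk ((x : G) * 1) : G ⧸ K) = _ at hx
  rw [mul_one, QuotientGroup.eq] at hx
  exact ⟨x, x.2, _, hx, by group⟩

/-- The last nontrivial term of the derived series is abelian, so its Sylow subgroups are
characteristic in it and therefore normal in the whole group. -/
lemma Group.IsSolvable.exists_normal_isPGroup {G : Type*} [Group G] [Finite G] [Nontrivial G]
    (hG : Group.IsSolvable G) :
    ∃ (p : ℕ) (M : Subgroup G), p.Prime ∧ M.Normal ∧ M ≠ ⊥ ∧ IsPGroup p M := by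
  classical
  have hex := hG.solvable
  let n := Nat.find hex
  have hn : derivedSeries G n = ⊥ := Nat.find_spec hex
  obtain ⟨m, hm⟩ : ∃ m, n = m + 1 := by
    refine Nat.exists_eq_succ_of_ne_zero fun h => ?_
    rw [h, derivedSeries_zero] at hn
    exact top_ne_bot hn
  have hA : derivedSeries G m ≠ ⊥ := Nat.find_min hex (show m < n by omega)
  set A := derivedSeries G m with hAdef
  rw [hm, derivedSeries_succ] at hn
  have hcomm : ∀ x y : A, x * y = y * x := fun x y => by
    have := (Subgroup.commutator_eq_bot_iff_le_centralizer.1 hn) x.2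
    exact Subtype.ext (Subgroup.mem_centralizer_iff.1 this y y.2).symm
  have : Nontrivial A := (Subgroup.nontrivial_iff_ne_bot A).2 hA
  obtain ⟨p, hp, hpA⟩ := Nat.exists_prime_and_dvd (Finite.one_lt_card (α := A)).ne'
  have := Fact.mk hp
  let P : Sylow p A := default
  have hPn : (P : Subgroup A).Normal := ⟨fun x hx y => by rw [hcomm y x]; simpa using hx⟩
  have := P.characteristic_of_normal hPn
  refine ⟨p, (P : Subgroup A).map A.subtype, hp, inferInstance, ?_, P.isPGroup'.map _⟩
  rw [Ne, Subgroup.map_eq_bot_iff_of_injective _ A.subtype_injective]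
  intro h
  have := P.dvd_card_of_dvd_card hpA
  rw [h, Subgroup.card_bot] at this
  exact hp.one_lt.ne' (Nat.dvd_one.1 this)

/-- A p-subgroup is contained in a conjugate of every subgroup of index prime to p. -/
lemma IsPGroup.exists_conj_le_of_not_dvd_index {G : Type*} [Group G] [Finite G] {p : ℕ}
    (hp : p.Prime) {M : Subgroup G} (hM : IsPGroup p M) {H : Subgroup G} (hH : ¬ p ∣ H.index) :
    ∃ g : G, M ≤ H.map (MulAut.conj g).toMonoidHom := by
  have := Fact.mk hp
  obtain ⟨⟨g⟩, hg⟩ := hM.nonempty_fixed_point_of_prime_not_dvd_card (G ⧸ H) hH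
  refine ⟨g, fun x hx => ?_⟩
  have h1 := hg ⟨x, hx⟩
  change (QuotientGroup.mk (x * g) : G ⧸ H) = QuotientGroup.mk g at h1
  have h2 := QuotientGroup.eq.1 h1.symm
  exact ⟨g⁻¹ * (x * g), h2, by simp [MulAut.conj_apply]⟩

/-- **Wielandt**: a finite group with three solvable subgroups of pairwise coprime indices is
solvable. -/
theorem Group.isSolvable_of_three_coprime_index (n : ℕ) : ∀ {G : Type*} [Group G] [Finite G],
    Nat.card G = n → ∀ H₁ H₂ H₃ : Subgroup G, Group.IsSolvable H₁ → Group.IsSolvable H₂ →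
    Group.IsSolvable H₃ → Nat.Coprime H₁.index H₂.index → Nat.Coprime H₁.index H₃.index →
    Nat.Coprime H₂.index H₃.index → Group.IsSolvable G := by
  induction n using Nat.strong_induction_on with
  | _ n ih =>
  intro G _ _ hn H₁ H₂ H₃ s₁ s₂ s₃ h₁₂ h₁₃ h₂₃
  have htop : ∀ {K : Subgroup G}, Group.IsSolvable K → K = ⊤ → Group.IsSolvable G := by
    rintro K hK rfl
    exact isSolvable_of_surjective (f := (⊤ : Subgroup G).subtype) fun x => ⟨⟨x, trivial⟩, rfl⟩
  by_cases hb : H₁ = ⊥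
  · rw [hb, Subgroup.index_bot] at h₁₂
    exact htop s₂ (Subgroup.index_eq_one.1
      (Nat.dvd_one.1 (h₁₂ ▸ Nat.dvd_gcd (Subgroup.index_dvd_card H₂) dvd_rfl)))
  have : Nontrivial H₁ := (Subgroup.nontrivial_iff_ne_bot H₁).2 hb
  obtain ⟨p, M, hp, hMn, hMb, hMp⟩ := s₁.exists_normal_isPGroup
  have hMp' : IsPGroup p (M.map H₁.subtype) := hMp.map _
  -- The indices of H₂ and H₃ are coprime, so p misses at least one of them.
  obtain ⟨K, sK, h₁K, hpK⟩ : ∃ K : Subgroup G, Group.IsSolvable K ∧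
      Nat.Coprime H₁.index K.index ∧ ¬ p ∣ K.index := by
    by_cases hp2 : p ∣ H₂.index
    · exact ⟨H₃, s₃, h₁₃, fun h3 => hp.one_lt.ne'
        (Nat.dvd_one.1 (h₂₃ ▸ Nat.dvd_gcd hp2 h3))⟩
    · exact ⟨H₂, s₂, h₁₂, hp2⟩
  obtain ⟨g, hg⟩ := hMp'.exists_conj_le_of_not_dvd_index hp hpK
  set L := K.map (MulAut.conj g).toMonoidHom with hL
  have sL : Group.IsSolvable L :=
    isSolvable_of_surjective (f := (MulAut.conj g).toMonoidHom.subgroupMap K)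
      (MonoidHom.subgroupMap_surjective _ _)
  have hLi : L.index = K.index := Subgroup.index_map_equiv K (MulAut.conj g)
  -- As G = L H₁ and M is normal in H₁, every conjugate of M is a conjugate by an element of L, so
  -- stays inside L. The core is thus a nontrivial solvable normal subgroup, and induction applies
  -- to the quotient.
  have hcore : M.map H₁.subtype ≤ L.normalCore := by
    intro x hx y
    obtain ⟨a, ha, b, hb, rfl⟩ := Subgroup.exists_mul_eq_of_coprime_index
      (H := L) (K := H₁) (by rw [hLi]; exact h₁K.symm) y
    obtain ⟨m, hm, rfl⟩ := hx
    have h1 : H₁.subtype ((⟨b, hb⟩ : H₁) * m * (⟨b, hb⟩ : H₁)⁻¹) ∈ L :=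
      hg ⟨_, hMn.conj_mem m hm ⟨b, hb⟩, rfl⟩
    have h2 := L.mul_mem (L.mul_mem ha h1) (L.inv_mem ha)
    convert h2 using 1
    simp; group
  have hNb : L.normalCore ≠ ⊥ := fun h => hMb (by
    rw [h, le_bot_iff, Subgroup.map_eq_bot_iff_of_injective _ H₁.subtype_injective] at hcore
    exact hcore)
  have sN : Group.IsSolvable L.normalCore :=
    isSolvable_of_isSolvable_injective (Subgroup.inclusion_injective L.normalCore_le)
  have hsurj := QuotientGroup.mk'_surjective L.normalCore
  have smap : ∀ H : Subgroup G, Group.IsSolvable H →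
      Group.IsSolvable (H.map (QuotientGroup.mk' L.normalCore)) := fun H hH =>
    isSolvable_of_surjective (f := (QuotientGroup.mk' L.normalCore).subgroupMap H)
      (MonoidHom.subgroupMap_surjective _ _)
  have hcop : ∀ H K : Subgroup G, Nat.Coprime H.index K.index →
      Nat.Coprime (H.map (QuotientGroup.mk' L.normalCore)).index
        (K.map (QuotientGroup.mk' L.normalCore)).index := fun H K h =>
    Nat.Coprime.of_dvd (Subgroup.index_map_dvd _ hsurj) (Subgroup.index_map_dvd _ hsurj) h
  refine (isSolvable_iff_subgroup_quotient L.normalCore).2 ⟨sN,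
    ih (Nat.card (G ⧸ L.normalCore)) ?_ rfl _ _ _ (smap _ s₁) (smap _ s₂) (smap _ s₃)
      (hcop _ _ h₁₂) (hcop _ _ h₁₃) (hcop _ _ h₂₃)⟩
  have hmul := Subgroup.card_mul_index L.normalCore
  have h1 : 1 < Nat.card L.normalCore := by
    rw [Finite.one_lt_card_iff_nontrivial]; exact (Subgroup.nontrivial_iff_ne_bot _).2 hNb
  have h3 : 0 < L.normalCore.index := Nat.pos_of_ne_zero Subgroup.index_ne_zero_of_finite
  change L.normalCore.index < n
  rw [← hn, ← hmul]; nlinarith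

/-- A finite group with a nested family of Hall subgroups, one for each unitary divisor of its
order, is solvable. -/
theorem Group.isSolvable_of_hall_family {G : Type*} [Group G] [Finite G] (H : ℕ → Subgroup G)
    (hmono : ∀ m m', m ∣ m' → H m ≤ H m')
    (hcard : ∀ m m', m * m' = Nat.card G → Nat.Coprime m m' → Nat.card (H m) = m) :
    Group.IsSolvable G := by
  suffices h : ∀ (k m m' : ℕ), m.primeFactors.card = k → m * m' = Nat.card G → Nat.Coprime m m' →
      Group.IsSolvable (H m) by
    have h1 := h _ (Nat.card G) 1 rfl (mul_one _) (Nat.coprime_one_right _)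
    have h2 : H (Nat.card G) = ⊤ := Subgroup.eq_top_of_card_eq _
      (hcard _ 1 (mul_one _) (Nat.coprime_one_right _))
    rw [h2] at h1
    exact isSolvable_of_surjective (f := (⊤ : Subgroup G).subtype) fun x => ⟨⟨x, trivial⟩, rfl⟩
  intro k
  induction k using Nat.strong_induction_on with
  | _ k ih =>
  intro m m' hk hm hco
  have hm0 : m ≠ 0 := fun h => Nat.card_pos.ne' (by rw [← hm, h, zero_mul] : Nat.card G = 0)
  have hHm := hcard m m' hm hco
  rcases le_or_gt k 2 with hk2 | hk2
  · obtain ⟨p, q, hp, hq, hpq⟩ : ∃ p q : ℕ, p.Prime ∧ q.Prime ∧ m.primeFactors ⊆ {p, q} := by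
      rw [← hk] at hk2
      interval_cases h : m.primeFactors.card
      · exact ⟨2, 2, Nat.prime_two, Nat.prime_two, by rw [Finset.card_eq_zero.1 h]; simp⟩
      · obtain ⟨p, hp⟩ := Finset.card_eq_one.1 h
        have : p.Prime := Nat.prime_of_mem_primeFactors (by rw [hp]; simp)
        exact ⟨p, p, this, this, by rw [hp]; simp⟩
      · obtain ⟨p, q, -, hpq⟩ := Finset.card_eq_two.1 h
        exact ⟨p, q, Nat.prime_of_mem_primeFactors (by rw [hpq]; simp),
          Nat.prime_of_mem_primeFactors (by rw [hpq]; simp), hpq.subset⟩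
    refine Group.isSolvable_of_card_eq_prime_pow_mul_prime_pow hp hq _ rfl fun r hr hrm => ?_
    rw [hHm] at hrm
    simpa using hpq (Nat.mem_primeFactors.2 ⟨hr, hrm, hm0⟩)
  -- Dropping one prime p from m gives a subgroup of `H m` whose index is the p-part of m; three
  -- primes give Wielandt's three subgroups.
  · have key : ∀ p ∈ m.primeFactors, Group.IsSolvable ((H (ordCompl[p] m)).subgroupOf (H m)) ∧
        ((H (ordCompl[p] m)).subgroupOf (H m)).index = ordProj[p] m := by
      intro p hp
      have hpp := Nat.prime_of_mem_primeFactors hp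
      have hdvd : ordCompl[p] m ∣ m := Nat.ordCompl_dvd m p
      have hpm : ordProj[p] m * ordCompl[p] m = m := Nat.ordProj_mul_ordCompl_eq_self m p
      have hc : Nat.Coprime (ordCompl[p] m) (ordProj[p] m * m') := by
        refine Nat.Coprime.mul_right ?_ (hco.coprime_dvd_left hdvd)
        exact ((Nat.coprime_ordCompl hpp hm0).pow_left _).symm
      have hmul : ordCompl[p] m * (ordProj[p] m * m') = Nat.card G := by
        rw [← hm, ← mul_assoc, mul_comm (ordCompl[p] m), hpm]
      have hle := hmono _ _ hdvd
      have hcc := hcard _ _ hmul hc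
      constructor
      · have := ih _ ?_ (ordCompl[p] m) (ordProj[p] m * m') rfl hmul hc
        · exact isSolvable_of_isSolvable_injective
            (f := (Subgroup.subgroupOfEquivOfLe hle).toMonoidHom)
            (Subgroup.subgroupOfEquivOfLe hle).injective
        · rw [← hk]
          refine Finset.card_lt_card ((Finset.ssubset_iff_of_subset
            (Nat.primeFactors_mono hdvd hm0)).2 ⟨p, hp, fun h => ?_⟩)
          exact Nat.not_dvd_ordCompl hpp hm0 (Nat.dvd_of_mem_primeFactors h)
      · have h1 := Subgroup.card_mul_index ((H (ordCompl[p] m)).subgroupOf (H m))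
        rw [Nat.card_congr (Subgroup.subgroupOfEquivOfLe hle).toEquiv, hcc, hHm] at h1
        rw [mul_comm, ← hpm] at h1
        have h2 : 0 < ordCompl[p] m := Nat.ordCompl_pos p hm0
        rw [hpm] at h1
        exact Nat.eq_of_mul_eq_mul_right h2 (h1.trans hpm.symm)
    rw [← hk, Finset.two_lt_card] at hk2
    obtain ⟨p, hp, q, hq, r, hr, hpq, hpr, hqr⟩ := hk2
    have hcop : ∀ p q : ℕ, p ∈ m.primeFactors → q ∈ m.primeFactors → p ≠ q →
        Nat.Coprime (ordProj[p] m) (ordProj[q] m) := fun p q hp hq hne =>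
      Nat.coprime_pow_primes _ _ (Nat.prime_of_mem_primeFactors hp)
        (Nat.prime_of_mem_primeFactors hq) hne
    refine Group.isSolvable_of_three_coprime_index _ rfl _ _ _ (key p hp).1 (key q hq).1
      (key r hr).1 ?_ ?_ ?_
    · rw [(key p hp).2, (key q hq).2]; exact hcop p q hp hq hpq
    · rw [(key p hp).2, (key r hr).2]; exact hcop p r hp hr hpr
    · rw [(key q hq).2, (key r hr).2]; exact hcop q r hq hr hqr

/-! ### Hall subgroups of finite nilpotent groups. -/

/-- The subgroup generated by the elements whose order divides `m`. -/
def Subgroup.powTorsion (A : Type*) [Group A] (m : ℕ) : Subgroup A :=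
  Subgroup.closure {a | a ^ m = 1}

lemma Subgroup.powTorsion_mono (A : Type*) [Group A] {m m' : ℕ} (h : m ∣ m') :
    Subgroup.powTorsion A m ≤ Subgroup.powTorsion A m' := by
  refine Subgroup.closure_mono fun a ha => ?_
  obtain ⟨k, rfl⟩ := h
  simp only [Set.mem_ofPred_eq] at ha ⊢
  rw [pow_mul, ha, one_pow]

lemma Subgroup.map_mem_powTorsion {A : Type*} [Group A] {m : ℕ} (f : A →* A) {a : A}
    (ha : a ∈ Subgroup.powTorsion A m) : f a ∈ Subgroup.powTorsion A m := by
  have : Subgroup.powTorsion A m ≤ (Subgroup.powTorsion A m).comap f := by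
    refine (Subgroup.closure_le _).2 fun x hx => Subgroup.subset_closure ?_
    simp only [Set.mem_ofPred_eq] at hx ⊢
    rw [← map_pow, hx, map_one]
  exact this ha

/-- In a finite nilpotent group the elements of order dividing a unitary divisor `m` of the group
order form a subgroup. -/
lemma Subgroup.pow_eq_one_of_mem_powTorsion {A : Type*} [Group A] [Finite A]
    (hA : Group.IsNilpotent A) {m m' : ℕ} (hm : m * m' = Nat.card A) (hco : Nat.Coprime m m')
    {a : A} (ha : a ∈ Subgroup.powTorsion A m) : a ^ m = 1 := by
  obtain ⟨e⟩ := ((Group.isNilpotent_of_finite_tfae (G := A)).out 0 4).1 hA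
  have hm0 : m ≠ 0 := fun h => Nat.card_pos.ne' (by rw [← hm, h, zero_mul] : Nat.card A = 0)
  -- In the decomposition of A as the product of its Sylow subgroups, T consists of the elements
  -- with trivial components at the primes not dividing m.
  let T : Subgroup A := ⨅ (p : (Nat.card A).primeFactors) (P : Sylow p A) (_ : ¬ (p : ℕ) ∣ m),
    (((Pi.evalMonoidHom _ P).comp (Pi.evalMonoidHom _ p)).comp e.symm.toMonoidHom).ker
  have hT : ∀ x, x ∈ T ↔ ∀ (p : (Nat.card A).primeFactors) (P : Sylow p A), ¬ (p : ℕ) ∣ m →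
      e.symm x p P = 1 := fun x => by
    simp only [T, Subgroup.mem_iInf, MonoidHom.mem_ker]
    rfl
  have hle : Subgroup.powTorsion A m ≤ T := by
    refine (Subgroup.closure_le _).2 fun x hx => (hT x).2 fun p P hp => ?_
    have hpp : (p : ℕ).Prime := Nat.prime_of_mem_primeFactors p.2
    have := Fact.mk hpp
    have h1 : (e.symm x p P) ^ m = 1 := by
      have : e.symm x ^ m = 1 := by rw [← map_pow, hx, map_one]
      exact congrFun (congrFun this p) P
    have h2 := P.isPGroup'.orderOf_coprime ((Nat.Prime.coprime_iff_not_dvd hpp).2 hp) (e.symm x p P)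
    exact orderOf_eq_one_iff.1 (Nat.eq_one_of_dvd_coprimes h2 dvd_rfl (orderOf_dvd_of_pow_eq_one h1))
  have haT := (hT a).1 (hle ha)
  apply e.symm.injective
  rw [map_pow, map_one]
  funext p P
  have hpp : (p : ℕ).Prime := Nat.prime_of_mem_primeFactors p.2
  have := Fact.mk hpp
  change (e.symm a p P) ^ m = 1
  by_cases hp : (p : ℕ) ∣ m
  · have h1 : Nat.card P ∣ m := by
      rw [P.card_eq_multiplicity]
      have hpm' : ¬ (p : ℕ) ∣ m' := fun h => hpp.one_lt.ne'
        (Nat.dvd_one.1 (hco ▸ Nat.dvd_gcd hp h))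
      refine Nat.Coprime.dvd_of_dvd_mul_right ?_ ((Nat.ordProj_dvd (Nat.card A) p).trans hm.symm.dvd)
      exact Nat.Coprime.pow_left _ ((Nat.Prime.coprime_iff_not_dvd hpp).2 hpm')
    obtain ⟨k, hk⟩ := h1
    rw [hk, pow_mul, pow_card_eq_one', one_pow]
  · rw [haT p P hp, one_pow]

/-- By Cauchy's theorem the orders of the m-part and the m'-part divide m and m'. By Bézout the two
parts multiply onto A, so both bounds are attained. -/
lemma Subgroup.card_powTorsion {A : Type*} [Group A] [Finite A]
    (hA : Group.IsNilpotent A) {m m' : ℕ} (hm : m * m' = Nat.card A) (hco : Nat.Coprime m m') :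
    Nat.card (Subgroup.powTorsion A m) = m := by
  have hm0 : 0 < m := Nat.pos_of_ne_zero fun h =>
    Nat.card_pos.ne' (by rw [← hm, h, zero_mul] : Nat.card A = 0)
  have hm0' : 0 < m' := Nat.pos_of_ne_zero fun h =>
    Nat.card_pos.ne' (by rw [← hm, h, mul_zero] : Nat.card A = 0)
  have hdvd : ∀ {k k' : ℕ}, 0 < k → k * k' = Nat.card A → Nat.Coprime k k' →
      Nat.card (Subgroup.powTorsion A k) ∣ k := by
    intro k k' hk0 hk hc
    have h1 : Nat.card (Subgroup.powTorsion A k) ∣ k * k' :=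
      hk ▸ Subgroup.card_subgroup_dvd_card _
    refine Nat.Coprime.dvd_of_dvd_mul_right (Nat.coprime_of_dvd fun r hr h2 h3 => ?_) h1
    have := Fact.mk hr
    obtain ⟨x, hx⟩ := exists_prime_orderOf_dvd_card' r h2
    have hx1 : x ^ k = 1 := Subtype.ext (Subgroup.pow_eq_one_of_mem_powTorsion hA hk hc x.2)
    have : r ∣ k := hx ▸ orderOf_dvd_of_pow_eq_one hx1
    exact hr.one_lt.ne' (Nat.dvd_one.1 (hc ▸ Nat.dvd_gcd this h3))
  have d1 := hdvd hm0 hm hco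
  have d2 := hdvd hm0' ((mul_comm _ _).trans hm) hco.symm
  have hsurj : Function.Surjective
      (fun x : Subgroup.powTorsion A m × Subgroup.powTorsion A m' => (x.1 : A) * x.2) := by
    intro a
    obtain ⟨u, v, huv⟩ := Nat.isCoprime_iff_coprime.2 hco
    refine ⟨⟨⟨a ^ (v * (m' : ℤ)), Subgroup.subset_closure ?_⟩,
      ⟨a ^ (u * (m : ℤ)), Subgroup.subset_closure ?_⟩⟩, ?_⟩
    · change (a ^ (v * (m' : ℤ))) ^ m = 1
      rw [← zpow_natCast, ← zpow_mul, show v * (m' : ℤ) * m = (Nat.card A : ℤ) * v by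
        rw [← hm]; push_cast; ring, zpow_mul, zpow_natCast, pow_card_eq_one', one_zpow]
    · change (a ^ (u * (m : ℤ))) ^ m' = 1
      rw [← zpow_natCast, ← zpow_mul, show u * (m : ℤ) * m' = (Nat.card A : ℤ) * u by
        rw [← hm]; push_cast; ring, zpow_mul, zpow_natCast, pow_card_eq_one', one_zpow]
    · change a ^ (v * (m' : ℤ)) * a ^ (u * (m : ℤ)) = a
      rw [← zpow_add, add_comm, huv, zpow_one]
  have hcard := Nat.card_le_card_of_surjective _ hsurj
  rw [Nat.card_prod, ← hm] at hcard
  refine le_antisymm (Nat.le_of_dvd hm0 d1) ?_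
  have l2 := Nat.le_of_dvd hm0' d2
  exact Nat.le_of_mul_le_mul_right (hcard.trans (Nat.mul_le_mul_left _ l2)) hm0'

/-! ### Solvability from a bijective cocycle into a nilpotent group. -/

section Cocycle

variable {A G : Type*} [Group A] [Group G] {φ : G →* MulAut A} {c : G ≃ A}

lemma cocycle_one (hc : ∀ g h, c (g * h) = c g * φ g (c h)) : c 1 = 1 := by
  have := hc 1 1
  simpa using this

/-- The preimage of an invariant subgroup under a cocycle. -/
def cocycleComap (hc : ∀ g h, c (g * h) = c g * φ g (c h)) (B : Subgroup A)
    (hB : ∀ g, ∀ b ∈ B, φ g b ∈ B) : Subgroup G where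
  carrier := {g | c g ∈ B}
  mul_mem' := fun {g h} hg hh => by
    change c (g * h) ∈ B
    rw [hc]; exact B.mul_mem hg (hB _ _ hh)
  one_mem' := by change c 1 ∈ B; rw [cocycle_one hc]; exact B.one_mem
  inv_mem' := fun {g} hg => by
    have h1 := hc g⁻¹ g
    rw [inv_mul_cancel, cocycle_one hc] at h1
    change c g⁻¹ ∈ B
    rw [eq_inv_of_mul_eq_one_left h1.symm]
    exact B.inv_mem (hB _ _ hg)

lemma card_cocycleComap (hc : ∀ g h, c (g * h) = c g * φ g (c h)) (B : Subgroup A)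
    (hB : ∀ g, ∀ b ∈ B, φ g b ∈ B) : Nat.card (cocycleComap hc B hB) = Nat.card B :=
  Nat.card_congr (c.subtypeEquiv fun _ => Iff.rfl)

/-- The multiplicative group of a finite skew brace of nilpotent type is solvable. -/
theorem isSolvable_of_bijective_cocycle [Finite A] [Finite G] (hA : Group.IsNilpotent A)
    (hc : ∀ g h, c (g * h) = c g * φ g (c h)) : Group.IsSolvable G := by
  have hinv : ∀ m g, ∀ b ∈ Subgroup.powTorsion A m, φ g b ∈ Subgroup.powTorsion A m :=
    fun m g b hb => Subgroup.map_mem_powTorsion (φ g).toMonoidHom hb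
  refine Group.isSolvable_of_hall_family
    (fun m => cocycleComap hc (Subgroup.powTorsion A m) (hinv m)) ?_ ?_
  · intro m m' h g hg
    exact Subgroup.powTorsion_mono A h hg
  · intro m m' h hco
    rw [card_cocycleComap]
    exact Subgroup.card_powTorsion hA (h.trans (Nat.card_congr c)) hco

end Cocycle

/-! ### Prime power index in solvable groups, and generators of p-components. -/

/-- A proper subgroup of a finite solvable group is contained in a proper subgroup of prime power
index. -/
theorem Group.IsSolvable.exists_le_index_eq_prime_pow (n : ℕ) : ∀ {G : Type*} [Group G] [Finite G],
    Nat.card G = n → Group.IsSolvable G → ∀ U : Subgroup G, U ≠ ⊤ →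
    ∃ (K : Subgroup G) (p m : ℕ), p.Prime ∧ U ≤ K ∧ K ≠ ⊤ ∧ K.index = p ^ m := by
  induction n using Nat.strong_induction_on with
  | _ n ih =>
  intro G _ _ hn hG U hU
  have : Nontrivial G := by
    by_contra h
    rw [not_nontrivial_iff_subsingleton] at h
    exact hU (Subsingleton.elim _ _)
  obtain ⟨p, M, hp, hM, hMb, hMp⟩ := hG.exists_normal_isPGroup
  have := Fact.mk hp
  -- If U and the normal p-subgroup M generate G, the index of U divides |M|. Otherwise the image of
  -- U in G/M is still proper.
  by_cases hUM : U ⊔ M = ⊤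
  · have h1 : M.relIndex U = M.index := by
      rw [← Subgroup.relIndex_sup_right, hUM, Subgroup.relIndex_top_right]
    have h2 : (U ⊓ M).index = M.index * U.index := by
      rw [← h1, ← Subgroup.inf_relIndex_left, Subgroup.relIndex_mul_index inf_le_left]
    have h3 : (U ⊓ M).relIndex M * M.index = (U ⊓ M).index :=
      Subgroup.relIndex_mul_index inf_le_right
    have h4 : U.index = (U ⊓ M).relIndex M := by
      rw [h2, mul_comm] at h3
      exact (Nat.eq_of_mul_eq_mul_left (Nat.pos_of_ne_zero Subgroup.index_ne_zero_of_finite) h3).symm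
    obtain ⟨k, hk⟩ := (IsPGroup.iff_card (p := p)).1 hMp
    have h5 : U.index ∣ p ^ k := by rw [h4, ← hk]; exact Subgroup.relIndex_dvd_card _ _
    obtain ⟨m, -, hm⟩ := (Nat.dvd_prime_pow hp).1 h5
    exact ⟨U, p, m, hp, le_rfl, hU, hm⟩
  · have hlt : Nat.card (G ⧸ M) < n := by
      have hmul := Subgroup.card_mul_index M
      have h1 : 1 < Nat.card M := by
        rw [Finite.one_lt_card_iff_nontrivial]; exact (Subgroup.nontrivial_iff_ne_bot _).2 hMb
      have h3 : 0 < M.index := Nat.pos_of_ne_zero Subgroup.index_ne_zero_of_finite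
      change M.index < n
      rw [← hn, ← hmul]; nlinarith
    have hsurj := QuotientGroup.mk'_surjective M
    obtain ⟨K, q, m, hq, hUK, hK, hKi⟩ := ih _ hlt rfl (isSolvable_of_surjective hsurj)
      (U.map (QuotientGroup.mk' M)) (fun h => hUM (by
        have h2 := congrArg (Subgroup.comap (QuotientGroup.mk' M)) h
        rwa [Subgroup.comap_map_eq, QuotientGroup.ker_mk', Subgroup.comap_top] at h2))
    refine ⟨K.comap (QuotientGroup.mk' M), q, m, hq, Subgroup.map_le_iff_le_comap.1 hUK, ?_, ?_⟩
    · intro h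
      apply hK
      rw [← Subgroup.map_comap_eq_self_of_surjective hsurj K, h, Subgroup.map_top_of_surjective _ hsurj]
    · rw [Subgroup.index_comap_of_surjective _ hsurj, hKi]

/-- Suitable powers of a generating set of a finite nilpotent group generate its p-component. -/
lemma Subgroup.powTorsion_le_of_pow_mem {A : Type*} [Group A] [Finite A]
    (hA : Group.IsNilpotent A) {X : Set A} (hX : Subgroup.closure X = ⊤) {m m' k : ℕ}
    (hm : m * m' = Nat.card A) (hco : Nat.Coprime m m') (hk : Nat.Coprime m k) {B : Subgroup A}
    (hB : ∀ y ∈ X, y ^ (k * m') ∈ B) : Subgroup.powTorsion A m ≤ B := by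
  wlog hBm : B ≤ Subgroup.powTorsion A m generalizing B
  · refine (this (B := B ⊓ Subgroup.powTorsion A m) (fun y hy => ⟨hB y hy, ?_⟩)
      inf_le_right).trans inf_le_left
    refine Subgroup.subset_closure ?_
    change (y ^ (k * m')) ^ m = 1
    rw [← pow_mul, mul_assoc, mul_comm m' m, hm, mul_comm, pow_mul, pow_card_eq_one', one_pow]
  have hinv : (Subgroup.powTorsion A m').Normal :=
    ⟨fun x hx g => Subgroup.map_mem_powTorsion (MulAut.conj g).toMonoidHom hx⟩
  have htop : B ⊔ Subgroup.powTorsion A m' = ⊤ := by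
    rw [eq_top_iff, ← hX, Subgroup.closure_le]
    intro y hy
    -- y is a product of powers of y^m, which lies in the m'-part, and of y^(k m'), which lies in B.
    obtain ⟨u, v, huv⟩ := Nat.isCoprime_iff_coprime.2 (Nat.Coprime.mul_right hk hco)
    have h1 : y ^ (k * m') ∈ B ⊔ Subgroup.powTorsion A m' := Subgroup.mem_sup_left (hB y hy)
    have h2 : y ^ m ∈ B ⊔ Subgroup.powTorsion A m' := by
      refine Subgroup.mem_sup_right (Subgroup.subset_closure ?_)
      change (y ^ m) ^ m' = 1
      rw [← pow_mul, hm, pow_card_eq_one']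
    have h3 := mul_mem (zpow_mem h2 u) (zpow_mem h1 v)
    rw [← zpow_natCast, ← zpow_natCast, ← zpow_mul, ← zpow_mul, ← zpow_add,
      mul_comm _ u, mul_comm _ v, huv, zpow_one] at h3
    exact h3
  intro a ha
  have haT : a ∈ B ⊔ Subgroup.powTorsion A m' := by rw [htop]; trivial
  obtain ⟨b, hb, d, hd, rfl⟩ := Subgroup.mem_sup_of_normal_right.1 haT
  have hd' : d ∈ Subgroup.powTorsion A m := (Subgroup.mul_mem_cancel_left _ (hBm hb)).1 ha
  have h1 := Subgroup.pow_eq_one_of_mem_powTorsion hA hm hco hd'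
  have h2 := Subgroup.pow_eq_one_of_mem_powTorsion hA ((mul_comm _ _).trans hm) hco.symm hd
  rw [orderOf_eq_one_iff.1 (Nat.eq_one_of_dvd_coprimes hco (orderOf_dvd_of_pow_eq_one h1)
    (orderOf_dvd_of_pow_eq_one h2)), mul_one]
  exact hb

/-! ### A transitive generating set of A under A ⋊ G. -/

section Main

variable {A G : Type*} [Group A] [Group G] {φ : G →* MulAut A} {c : G ≃ A}

/-- The action of the semidirect product on the normal factor. -/
def semidirectConj (φ : G →* MulAut A) : A ⋊[φ] G →* MulAut A :=
  SemidirectProduct.lift MulAut.conj φ fun g => by ext; simp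

lemma semidirectConj_apply (γ : A ⋊[φ] G) (x : A) :
    semidirectConj φ γ x = γ.left * φ γ.right x * γ.left⁻¹ := by
  simp [semidirectConj, SemidirectProduct.lift]

/-- On powers of x^k the cocycle is untwisted, because the element of G corresponding to x^k fixes
x. -/
lemma cocycle_pow (hc : ∀ g h, c (g * h) = c g * φ g (c h)) {x : A} {k : ℕ}
    (hk : φ (c.symm (x ^ k)) x = x) (j : ℕ) : c.symm (x ^ (k * j)) = c.symm (x ^ k) ^ j := by
  rw [Equiv.symm_apply_eq]
  induction j with
  | zero => simp [cocycle_one hc]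
  | succ j ih =>
    rw [pow_succ', hc, ← ih, Equiv.apply_symm_apply, map_pow, hk, ← pow_add]
    congr 1; ring

/-- The subgroup `B ⋊ c⁻¹ B` of `A ⋊ G`. -/
def cocycleSemidirect (hc : ∀ g h, c (g * h) = c g * φ g (c h)) (B : Subgroup A)
    (hB : ∀ g, ∀ b ∈ B, φ g b ∈ B) : Subgroup (A ⋊[φ] G) where
  carrier := {γ | γ.left ∈ B ∧ γ.right ∈ cocycleComap hc B hB}
  mul_mem' := fun h h' => ⟨B.mul_mem h.1 (hB _ _ h'.1), mul_mem h.2 h'.2⟩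
  one_mem' := ⟨one_mem _, one_mem _⟩
  inv_mem' := fun h => ⟨hB _ _ (inv_mem h.1), inv_mem h.2⟩

lemma card_cocycleSemidirect (hc : ∀ g h, c (g * h) = c g * φ g (c h)) (B : Subgroup A)
    (hB : ∀ g, ∀ b ∈ B, φ g b ∈ B) :
    Nat.card (cocycleSemidirect hc B hB) = Nat.card B * Nat.card B := by
  have e : cocycleSemidirect hc B hB ≃ B × cocycleComap hc B hB :=
    { toFun := fun γ => (⟨γ.1.left, γ.2.1⟩, ⟨γ.1.right, γ.2.2⟩)
      invFun := fun b => ⟨⟨b.1, b.2⟩, b.1.2, b.2.2⟩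
      left_inv := fun _ => rfl
      right_inv := fun _ => rfl }
  rw [Nat.card_congr e, Nat.card_prod, card_cocycleComap]

/-- Each y^(k q'), acting by conjugation, and its cocycle preimage, acting through φ, fix y, and
such elements generate a Sylow p-subgroup of A ⋊ G. An orbit with more than one point would confine
them all to one maximal subgroup of it. -/
theorem subsingleton_of_bijective_cocycle [Finite A] [Finite G] (hA : Group.IsNilpotent A)
    (hc : ∀ g h, c (g * h) = c g * φ g (c h)) {X : Set A} (hX : Subgroup.closure X = ⊤)
    (hφ : ∀ g, ∀ x ∈ X, φ g x ∈ X) (hconj : ∀ a, ∀ x ∈ X, a * x * a⁻¹ ∈ X)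
    (htrans : ∀ x ∈ X, ∀ y ∈ X, ∃ γ, semidirectConj φ γ x = y) {k : ℕ}
    (hk : ∀ x ∈ X, φ (c.symm (x ^ k)) x = x) (hcop : Nat.Coprime X.ncard k) :
    X.Subsingleton := by
  classical
  by_contra hns
  rw [Set.not_subsingleton_iff] at hns
  obtain ⟨x, hx, x', hx', hxx'⟩ := hns
  have hfin : Finite (A ⋊[φ] G) := Finite.of_equiv _ SemidirectProduct.equivProd.symm
  have hsolG := isSolvable_of_bijective_cocycle hA hc
  have hsolA : Group.IsSolvable A := inferInstance
  have hsol : Group.IsSolvable (A ⋊[φ] G) :=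
    Group.isSolvable_of_ker_le_range (SemidirectProduct.inl) (SemidirectProduct.rightHom)
      SemidirectProduct.range_inl_eq_ker_rightHom.ge
  let U : Subgroup (A ⋊[φ] G) := (MulAction.stabilizer (MulAut A) x).comap (semidirectConj φ)
  have hUmem : ∀ γ, γ ∈ U ↔ semidirectConj φ γ x = x := fun γ => Iff.rfl
  have hUi : U.index = X.ncard := by
    let : MulAction (A ⋊[φ] G) A := MulAction.compHom A (semidirectConj φ)
    have h1 : U = MulAction.stabilizer (A ⋊[φ] G) x := rfl
    rw [h1, MulAction.index_stabilizer]
    congr 1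
    ext y
    constructor
    · rintro ⟨γ, rfl⟩
      change semidirectConj φ γ x ∈ X
      rw [semidirectConj_apply]
      exact hconj _ _ (hφ _ _ hx)
    · intro hy
      exact htrans x hx y hy
  have hU : U ≠ ⊤ := by
    intro h
    obtain ⟨γ, hγ⟩ := htrans x hx x' hx'
    have : γ ∈ U := by rw [h]; trivial
    exact hxx' (((hUmem γ).1 this).symm.trans hγ)
  obtain ⟨K, p, m, hp, hUK, hK, hKi⟩ := hsol.exists_le_index_eq_prime_pow _ rfl U hU
  have := Fact.mk hp
  have hpk : Nat.Coprime p k := by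
    have h1 : p ∣ K.index := by
      rw [hKi]
      refine dvd_pow_self p fun hm => hK (Subgroup.index_eq_one.1 ?_)
      rw [hKi, hm, pow_zero]
    exact hcop.coprime_dvd_left (h1.trans (hUi ▸ Subgroup.index_dvd_of_le hUK))
  have hA0 : Nat.card A ≠ 0 := Nat.card_pos.ne'
  set q := ordProj[p] (Nat.card A) with hq
  set q' := ordCompl[p] (Nat.card A) with hq'
  have hqq : q * q' = Nat.card A := Nat.ordProj_mul_ordCompl_eq_self _ p
  have hpq' : Nat.Coprime p q' := Nat.coprime_ordCompl hp hA0
  have hcoq : Nat.Coprime q q' := hpq'.pow_left _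
  have hinv : ∀ g, ∀ b ∈ Subgroup.powTorsion A q, φ g b ∈ Subgroup.powTorsion A q :=
    fun g b hb => Subgroup.map_mem_powTorsion (φ g).toMonoidHom hb
  -- Q has order q² and index q'², so it is a Sylow p-subgroup of A ⋊ G, and its index is coprime to
  -- that of K.
  let Q := cocycleSemidirect hc (Subgroup.powTorsion A q) hinv
  have hQcard : Nat.card Q = q * q := by
    rw [card_cocycleSemidirect, Subgroup.card_powTorsion hA hqq hcoq]
  have hQi : Q.index = q' * q' := by
    have h1 := Subgroup.card_mul_index Q
    rw [hQcard, SemidirectProduct.card, Nat.card_congr c, ← hqq] at h1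
    have h2 : 0 < q := Nat.ordProj_pos _ _
    have h3 : (q * q) * Q.index = (q * q) * (q' * q') := by rw [h1]; ring
    exact Nat.eq_of_mul_eq_mul_left (by positivity) h3
  have hQp : IsPGroup p Q := by
    refine IsPGroup.of_card (n := (Nat.card A).factorization p + (Nat.card A).factorization p) ?_
    rw [hQcard, pow_add]
  have hQK : ∀ γ, ∃ a ∈ Q, ∃ b ∈ K, a * b = γ := Subgroup.exists_mul_eq_of_coprime_index (by
    rw [hQi, hKi]
    exact (Nat.Coprime.mul_right hpq' hpq').symm.pow_right m)
  have hKQ : K.subgroupOf Q ≠ ⊤ := by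
    intro h
    rw [Subgroup.subgroupOf_eq_top] at h
    refine hK (eq_top_iff.2 fun γ _ => ?_)
    obtain ⟨a, ha, b, hb, rfl⟩ := hQK γ
    exact K.mul_mem (h ha) hb
  obtain ⟨M, hM, hKM⟩ := (eq_top_or_exists_le_coatom (K.subgroupOf Q)).resolve_left hKQ
  have hQnil : Group.IsNilpotent Q := hQp.isNilpotent
  have hMn : M.Normal :=
    Subgroup.NormalizerCondition.normal_of_coatom M Group.normalizerCondition_of_isNilpotent hM
  let M' : Subgroup (A ⋊[φ] G) := M.map Q.subtype
  have hM'mem : ∀ γ, ∀ h : γ ∈ Q, (⟨γ, h⟩ : Q) ∈ M → γ ∈ M' := fun γ h h' => ⟨_, h', rfl⟩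
  -- Write y = (ab)·x with a ∈ Q and b ∈ K. Conjugating by a moves the stabilizer of y in Q into K ∩
  -- Q ≤ M, and M is normal in Q.
  have hstab : ∀ y ∈ X, ∀ γ ∈ Q, semidirectConj φ γ y = y → γ ∈ M' := by
    intro y hy γ hγ hfix
    obtain ⟨δ, rfl⟩ := htrans x hx y hy
    obtain ⟨a, ha, b, hb, rfl⟩ := hQK δ
    have h1 : (a * b)⁻¹ * γ * (a * b) ∈ U := by
      rw [hUmem, map_mul, map_mul, MulAut.mul_apply, MulAut.mul_apply, hfix, map_inv,
        MulAut.inv_apply_self]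
    have h2 : a⁻¹ * γ * a ∈ K := by
      have := K.mul_mem (K.mul_mem hb (hUK h1)) (K.inv_mem hb)
      convert this using 1; group
    have h3 : (⟨a, ha⟩ : Q)⁻¹ * ⟨γ, hγ⟩ * ⟨a, ha⟩ ∈ M := hKM (Subgroup.mem_subgroupOf.2 h2)
    have h4 := hMn.conj_mem _ h3 ⟨a, ha⟩
    refine hM'mem γ hγ ?_
    convert h4 using 1; group
  have hyq : ∀ y ∈ X, y ^ (k * q') ∈ Subgroup.powTorsion A q := fun y _ => by
    refine Subgroup.subset_closure ?_
    change (y ^ (k * q')) ^ q = 1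
    rw [← pow_mul, mul_assoc, mul_comm q' q, hqq, mul_comm, pow_mul, pow_card_eq_one', one_pow]
  have hgen : ∀ B : Subgroup A, (∀ y ∈ X, y ^ (k * q') ∈ B) → Subgroup.powTorsion A q ≤ B :=
    fun B => Subgroup.powTorsion_le_of_pow_mem hA hX hqq hcoq (hpk.pow_left _)
  have hleft : ∀ a ∈ Subgroup.powTorsion A q, (SemidirectProduct.inl a : A ⋊[φ] G) ∈ M' := by
    refine hgen (M'.comap SemidirectProduct.inl) fun y hy => ?_
    refine hstab y hy _ ⟨hyq y hy, one_mem _⟩ ?_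
    rw [semidirectConj_apply]
    simp only [SemidirectProduct.left_inl, SemidirectProduct.right_inl, map_one, MulAut.one_apply]
    rw [← pow_succ, pow_succ']; group
  have hW : ∀ y ∈ X, (SemidirectProduct.inr (c.symm (y ^ (k * q'))) : A ⋊[φ] G) ∈ M' := by
    intro y hy
    refine hstab y hy _ ⟨one_mem _, ?_⟩ ?_
    · change c (SemidirectProduct.inr (c.symm (y ^ (k * q'))) : A ⋊[φ] G).right ∈
        Subgroup.powTorsion A q
      rw [SemidirectProduct.right_inr, Equiv.apply_symm_apply]; exact hyq y hy
    · rw [semidirectConj_apply]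
      simp only [SemidirectProduct.left_inr, SemidirectProduct.right_inr, one_mul, inv_one, mul_one]
      rw [cocycle_pow hc (hk y hy), map_pow]
      exact (MulAction.stabilizer (MulAut A) y).pow_mem (hk y hy) q'
  let W : Set A := (fun y => y ^ (k * q')) '' X
  have hWmem : ∀ g, ∀ w ∈ W, (SemidirectProduct.inr (c.symm (φ g⁻¹ w)) : A ⋊[φ] G) ∈ M' := by
    rintro g _ ⟨y, hy, rfl⟩
    change (SemidirectProduct.inr (c.symm (φ g⁻¹ (y ^ (k * q')))) : A ⋊[φ] G) ∈ M'
    rw [map_pow]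
    exact hW _ (hφ _ _ hy)
  -- Multiplying by w in A is multiplying in G by the preimage of a twisted w. As W is G-stable,
  -- generation of the p-part of A by W transfers to the p-part of G.
  have hmulW : ∀ g, ∀ w, c.symm (c g * w) = g * c.symm (φ g⁻¹ w) := fun g w => by
    rw [Equiv.symm_apply_eq, hc, Equiv.apply_symm_apply, map_inv, MulAut.apply_inv_self]
  have hclW : ∀ a ∈ Subgroup.closure W, (SemidirectProduct.inr (c.symm a) : A ⋊[φ] G) ∈ M' := by
    intro a ha
    induction ha using Subgroup.closure_induction_right with
    | one =>
      rw [← cocycle_one hc, Equiv.symm_apply_apply, map_one]; exact one_mem _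
    | mul_right a _ w hw ih =>
      have := hmulW (c.symm a) w
      rw [Equiv.apply_symm_apply] at this
      rw [this, map_mul]
      exact mul_mem ih (hWmem _ w hw)
    | mul_inv_cancel a _ w hw ih =>
      have := hmulW (c.symm (a * w⁻¹)) w
      rw [Equiv.apply_symm_apply, inv_mul_cancel_right] at this
      rw [this, map_mul] at ih
      exact (Subgroup.mul_mem_cancel_right _ (hWmem _ w hw)).1 ih
  have hright : ∀ g, c g ∈ Subgroup.powTorsion A q → (SemidirectProduct.inr g : A ⋊[φ] G) ∈ M' := by
    intro g hg
    have := hclW (c g) (hgen (Subgroup.closure W)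
      (fun y hy => Subgroup.subset_closure ⟨y, hy, rfl⟩) hg)
    rwa [Equiv.symm_apply_apply] at this
  refine hM.1 (eq_top_iff.2 ?_)
  rintro ⟨γ, hγ⟩ -
  have h1 : γ ∈ M' := by
    rw [← SemidirectProduct.inl_left_mul_inr_right γ]
    exact mul_mem (hleft _ hγ.1) (hright _ hγ.2)
  obtain ⟨⟨γ', h'⟩, h2, rfl⟩ := h1
  exact h2

end Main

/-! ### The derived rack, the derived group and its action on rack automorphisms. -/

namespace YBSolution

variable {X : Type*} (S : YBSolution X)

lemma r_apply (x y : X) : S.r (x, y) = (S.lam x y, S.rho y x) := rfl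

lemma lam_lam (x y z : X) : S.lam (S.lam x y) (S.lam (S.rho y x) z) = S.lam x (S.lam y z) :=
  congrArg (fun t => t.1) (congrFun S.braid (x, y, z))

lemma rho_lam (x y z : X) :
    S.rho (S.lam (S.rho y x) z) (S.lam x y) = S.lam (S.rho (S.lam y z) x) (S.rho z y) :=
  congrArg (fun t => t.2.1) (congrFun S.braid (x, y, z))

lemma sigma_lam (x w : X) : S.sigma (S.lam x w) x = S.lam (S.lam x w) (S.rho w x) := by
  rw [sigma, Equiv.symm_apply_apply]

/-- After the substitution y = `lam u z`, this is the braid relation in its first two coordinates.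
-/
lemma lam_sigma (x y u : X) : S.lam x (S.sigma y u) = S.sigma (S.lam x y) (S.lam x u) := by
  obtain ⟨z, rfl⟩ := (S.lam u).surjective y
  rw [sigma_lam, ← S.lam_lam x u z, sigma_lam, rho_lam, S.lam_lam x u z, S.lam_lam]

lemma sigma_injective (y : X) : Function.Injective (S.sigma y) := by
  intro x x' h
  have h1 := (S.lam y).injective h
  have h2 : S.r (x, (S.lam x).symm y) = S.r (x', (S.lam x').symm y) := by
    rw [r_apply, r_apply, Equiv.apply_symm_apply, Equiv.apply_symm_apply, h1]
  exact congrArg Prod.fst (S.bijective.1 h2)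

lemma lam_diagonal (x : X) : S.lam x (S.diagonal x) = x := (S.lam x).apply_symm_apply x

/-- x can be recovered from q(x), since ρ_{q(x)}(x) = σ_{q(x)}(q(x)) and ρ_{q(x)} is injective. -/
lemma diagonal_injective : Function.Injective S.diagonal := by
  have key : ∀ x, S.rho (S.diagonal x) x = S.sigma (S.diagonal x) (S.diagonal x) := fun x => by
    apply (S.lam x).injective
    rw [lam_sigma, lam_diagonal]; rfl
  intro x x' h
  have h1 := key x
  rw [h, ← key x'] at h1
  exact (S.rho _).injective h1

/-- The automorphisms of the derived rack. -/
def rackAut : Subgroup (Equiv.Perm X) where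
  carrier := {f | ∀ y x, f (S.sigma y x) = S.sigma (f y) (f x)}
  mul_mem' := fun {f g} hf hg y x => by
    rw [Equiv.Perm.mul_apply, hg, hf]; rfl
  one_mem' := fun _ _ => rfl
  inv_mem' := fun {f} hf y x => by
    rw [Equiv.Perm.inv_eq_iff_eq, hf]
    exact congrArg₂ S.sigma (f.apply_symm_apply y).symm (f.apply_symm_apply x).symm

/-- The permutation `lam x` as an automorphism of the derived rack. -/
noncomputable def lamAut (x : X) : S.rackAut := ⟨S.lam x, S.lam_sigma x⟩

lemma lamAut_mul (u w : X) :
    S.lamAut (S.lam u w) * S.lamAut (S.rho w u) = S.lamAut u * S.lamAut w :=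
  Subtype.ext (Equiv.ext fun z => S.lam_lam u w z)

/-- The generator `x` of the derived group. -/
def gen (x : X) : S.DerivedGroup := PresentedGroup.of x

lemma gen_mul_gen (x y : X) : S.gen x * S.gen y = S.gen y * S.gen (S.sigma y x) := by
  have h : (FreeGroup.of x * FreeGroup.of y) * (FreeGroup.of y * FreeGroup.of (S.sigma y x))⁻¹ ∈
      S.derivedRels := ⟨x, y, rfl⟩
  have h1 := PresentedGroup.one_of_mem h
  rw [map_mul, map_inv, mul_inv_eq_one] at h1
  rw [map_mul, map_mul] at h1
  exact h1

lemma closure_range_gen : Subgroup.closure (Set.range S.gen) = ⊤ :=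
  PresentedGroup.closure_range_of _

/-- A map on generators compatible with the defining relations extends to the derived group. -/
def liftGen {H : Type*} [Group H] (f : X → H)
    (hf : ∀ x y, f x * f y = f y * f (S.sigma y x)) : S.DerivedGroup →* H :=
  PresentedGroup.toGroup (f := f) (by
    rintro _ ⟨x, y, rfl⟩
    simp [hf x y])

@[simp] lemma liftGen_gen {H : Type*} [Group H] (f : X → H)
    (hf : ∀ x y, f x * f y = f y * f (S.sigma y x)) (x : X) : S.liftGen f hf (S.gen x) = f x :=
  PresentedGroup.toGroup.of _

lemma hom_ext {H : Type*} [Group H] {f g : S.DerivedGroup →* H}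
    (h : ∀ x, f (S.gen x) = g (S.gen x)) : f = g := PresentedGroup.ext h

/-- The endomorphism of the derived group induced by a rack automorphism. -/
def autHom (g : S.rackAut) : S.DerivedGroup →* S.DerivedGroup :=
  S.liftGen (fun x => S.gen (g.1 x)) fun x y => by rw [gen_mul_gen, g.2]

@[simp] lemma autHom_gen (g : S.rackAut) (x : X) : S.autHom g (S.gen x) = S.gen (g.1 x) :=
  S.liftGen_gen _ _ x

lemma autHom_mul (g h : S.rackAut) : (S.autHom g).comp (S.autHom h) = S.autHom (g * h) :=
  S.hom_ext fun x => by simp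

lemma autHom_one : S.autHom 1 = MonoidHom.id _ := S.hom_ext fun x => by simp

/-- The action of rack automorphisms on the derived group. -/
def aut : S.rackAut →* MulAut S.DerivedGroup where
  toFun g := (S.autHom g).toMulEquiv (S.autHom g⁻¹)
    (by rw [autHom_mul, inv_mul_cancel, autHom_one]) (by rw [autHom_mul, mul_inv_cancel, autHom_one])
  map_one' := by ext x; exact DFunLike.congr_fun S.autHom_one x
  map_mul' g h := by ext x; exact (DFunLike.congr_fun (S.autHom_mul g h) x).symm

@[simp] lemma aut_gen (g : S.rackAut) (x : X) : S.aut g (S.gen x) = S.gen (g.1 x) :=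
  S.autHom_gen g x

variable [Finite X]

/-- Right multiplication by a generator, `f ↦ f * lam (f⁻¹ x)`, on rack automorphisms. -/
noncomputable def step (x : X) : Equiv.Perm S.rackAut :=
  Equiv.ofBijective (fun f => f * S.lamAut (f.1⁻¹ x)) <| by
    rw [← Finite.injective_iff_bijective]
    intro f f' h
    have h1 : f.1 * S.lam (f.1⁻¹ x) = f'.1 * S.lam (f'.1⁻¹ x) := congrArg Subtype.val h
    -- The image of g under the step determines q(g⁻¹ x), hence g⁻¹ x because q is injective, hence
    -- g.
    have key : ∀ g : S.rackAut, (g.1 * S.lam (g.1⁻¹ x))⁻¹ x = S.diagonal (g.1⁻¹ x) := fun g => by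
      rw [mul_inv_rev, Equiv.Perm.mul_apply]; rfl
    have h2 : f.1⁻¹ x = f'.1⁻¹ x := S.diagonal_injective (by rw [← key, ← key, h1])
    rw [h2] at h1
    exact Subtype.ext (mul_right_cancel h1)

lemma step_apply (x : X) (f : S.rackAut) : S.step x f = f * S.lamAut (f.1⁻¹ x) := rfl

/-- This is the defining relation of the derived group for an action from the right, whence the
opposite group in `rightAction`. It reduces to `lamAut_mul` at u = f⁻¹ x. -/
lemma step_mul_step (x y : X) : S.step y * S.step x = S.step (S.sigma y x) * S.step y := by
  ext1 f
  rw [Equiv.Perm.mul_apply, Equiv.Perm.mul_apply, step_apply, step_apply, step_apply, step_apply,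
    mul_assoc, mul_assoc]
  have e1 : ∀ u z : X, (f * S.lamAut u).1⁻¹ z = (S.lam u).symm (f.1⁻¹ z) := fun u z => by
    change (f.1 * S.lam u)⁻¹ z = _
    rw [mul_inv_rev]; rfl
  have e2 : f.1⁻¹ (S.sigma y x) = S.sigma (f.1⁻¹ y) (f.1⁻¹ x) := (S.rackAut.inv_mem f.2) y x
  rw [e1, e1, e2]
  set u := f.1⁻¹ x
  set v := f.1⁻¹ y
  obtain ⟨w, hw⟩ := (S.lam u).surjective v
  rw [← hw, Equiv.symm_apply_apply, sigma_lam, Equiv.symm_apply_apply, lamAut_mul]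

/-- The right action of the derived group on rack automorphisms. -/
noncomputable def rightAction : S.DerivedGroup →* (Equiv.Perm S.rackAut)ᵐᵒᵖ :=
  S.liftGen (fun x => MulOpposite.op (S.step x)) fun x y => by
    rw [← MulOpposite.op_mul, ← MulOpposite.op_mul, step_mul_step]

lemma rightAction_gen (x : X) : S.rightAction (S.gen x) = MulOpposite.op (S.step x) :=
  S.liftGen_gen _ _ x

lemma rightAction_aut (g : S.rackAut) (d : S.DerivedGroup) : S.rightAction (S.aut g d) =
    MulOpposite.op (Equiv.mulLeft g * (S.rightAction d).unop * (Equiv.mulLeft g)⁻¹) := by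
  have : S.rightAction.comp (S.aut g).toMonoidHom =
      (MulAut.conj (MulOpposite.op (Equiv.mulLeft g))⁻¹).toMonoidHom.comp S.rightAction := by
    refine S.hom_ext fun x => ?_
    change S.rightAction (S.aut g (S.gen x)) = (MulOpposite.op (Equiv.mulLeft g))⁻¹ *
      S.rightAction (S.gen x) * ((MulOpposite.op (Equiv.mulLeft g))⁻¹)⁻¹
    rw [aut_gen, rightAction_gen, rightAction_gen]
    apply MulOpposite.unop_injective
    ext1 f
    change S.step (g.1 x) f = g * S.step x (g⁻¹ * f)
    rw [step_apply, step_apply, ← mul_assoc, mul_inv_cancel_left]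
    congr 2
  have h := DFunLike.congr_fun this d
  refine h.trans ?_
  change (MulOpposite.op (Equiv.mulLeft g))⁻¹ * S.rightAction d *
    ((MulOpposite.op (Equiv.mulLeft g))⁻¹)⁻¹ = _
  rw [inv_inv]
  apply MulOpposite.unop_injective
  simp [mul_assoc]

/-- The subgroup of central elements acting trivially on rack automorphisms. -/
noncomputable def socle : Subgroup S.DerivedGroup :=
  S.rightAction.ker ⊓ Subgroup.center S.DerivedGroup

instance socle_normal : S.socle.Normal := inferInstanceAs (_ ⊓ _ : Subgroup _).Normal

lemma aut_mem_socle (g : S.rackAut) {d : S.DerivedGroup} (hd : d ∈ S.socle) :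
    S.aut g d ∈ S.socle := by
  refine Subgroup.mem_inf.2 ⟨?_, ?_⟩
  · have h1 : S.rightAction d = 1 := hd.1
    rw [MonoidHom.mem_ker, rightAction_aut, h1, MulOpposite.unop_one, mul_one, mul_inv_cancel,
      MulOpposite.op_one]
  · have h2 := (Subgroup.mem_inf.1 hd).2
    rw [Subgroup.mem_center_iff] at h2 ⊢
    intro e
    obtain ⟨e, rfl⟩ := (S.aut g).surjective e
    rw [← map_mul, h2, map_mul]

lemma socle_map_aut (g : S.rackAut) : S.socle.map (S.aut g : S.DerivedGroup →* _) = S.socle := by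
  apply le_antisymm
  · rintro _ ⟨d, hd, rfl⟩
    exact S.aut_mem_socle g hd
  · intro d hd
    exact ⟨S.aut g⁻¹ d, S.aut_mem_socle _ hd, by simp⟩

lemma conj_gen_mem (d : S.DerivedGroup) : ∀ x, d * S.gen x * d⁻¹ ∈ Set.range S.gen := by
  have hd : d ∈ Subgroup.closure (Set.range S.gen) := by rw [closure_range_gen]; trivial
  have hinv : ∀ x y, (S.gen y)⁻¹ * S.gen x * S.gen y = S.gen (S.sigma y x) := fun x y => by
    rw [mul_assoc, gen_mul_gen, inv_mul_cancel_left]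
  induction hd using Subgroup.closure_induction'' with
  | mem d hd =>
    obtain ⟨y, rfl⟩ := hd
    intro x
    obtain ⟨x', rfl⟩ := (Finite.injective_iff_surjective.1 (S.sigma_injective y)) x
    exact ⟨x', by rw [← hinv]; group⟩
  | inv_mem d hd =>
    obtain ⟨y, rfl⟩ := hd
    intro x
    exact ⟨_, by rw [inv_inv, hinv]⟩
  | one => intro x; exact ⟨x, by simp⟩
  | mul a b _ _ ha hb =>
    intro x
    obtain ⟨y, hy⟩ := hb x
    obtain ⟨z, hz⟩ := ha y
    exact ⟨z, by rw [hz, hy]; group⟩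

/-- The center is the intersection of the centralizers of finitely many generators, and each
generator has finitely many conjugates, all of them generators. -/
lemma finiteIndex_center : (Subgroup.center S.DerivedGroup).FiniteIndex := by
  have h1 : Subgroup.center S.DerivedGroup = ⨅ x, Subgroup.centralizer {S.gen x} := by
    rw [← Subgroup.centralizer_univ, ← Subgroup.coe_top, ← closure_range_gen,
      Subgroup.centralizer_closure]
    ext d
    simp [Subgroup.mem_iInf, Subgroup.mem_centralizer_iff]
  rw [h1]
  have : ∀ x, (Subgroup.centralizer {S.gen x}).FiniteIndex := fun x => by
    constructor
    have h2 : (Subgroup.centralizer {S.gen x}).index =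
        (MulAction.orbit (ConjAct S.DerivedGroup) (S.gen x)).ncard := by
      rw [← MulAction.index_stabilizer, ConjAct.stabilizer_eq_centralizer]; rfl
    have hfin : (MulAction.orbit (ConjAct S.DerivedGroup) (S.gen x)).Finite := by
      refine (Set.finite_range S.gen).subset ?_
      rintro _ ⟨d, rfl⟩
      exact S.conj_gen_mem (ConjAct.ofConjAct d) x
    rw [h2]
    exact ((Set.ncard_pos hfin).2 (MulAction.nonempty_orbit _)).ne'
  exact Subgroup.finiteIndex_iInf this

instance finite_quotient_socle : Finite (S.DerivedGroup ⧸ S.socle) := by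
  have := S.finiteIndex_center
  have : Finite (Equiv.Perm S.rackAut)ᵐᵒᵖ := Finite.of_equiv _ MulOpposite.opEquiv
  have : S.rightAction.ker.FiniteIndex := Subgroup.finiteIndex_ker _
  have : S.socle.FiniteIndex := inferInstanceAs (_ ⊓ _ : Subgroup _).FiniteIndex
  exact Subgroup.finite_quotient_of_finiteIndex

end YBSolution

/-! ### Decomposability, the finite skew brace, and the collapse of the generators. -/

namespace YBSolution

variable {X : Type*} (S : YBSolution X)

/-- The permutation `sigma y`. -/
noncomputable def sigmaPerm [Finite X] (y : X) : Equiv.Perm X :=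
  Equiv.ofBijective (S.sigma y) (Finite.injective_iff_bijective.1 (S.sigma_injective y))

/-- The permutation group generated by all `lam x` and `sigma y`. -/
noncomputable def permGroup [Finite X] : Subgroup (Equiv.Perm X) :=
  Subgroup.closure (Set.range S.lam ∪ Set.range S.sigmaPerm)

/-- ρ_v(u) is obtained from u by applying σ_w and then λ_w⁻¹, where w = λ_u(v). -/
lemma mapsTo_r_of_invariant {Y : Set X} (hl : ∀ x, ∀ y ∈ Y, S.lam x y ∈ Y)
    (hl' : ∀ x, ∀ y ∈ Y, (S.lam x).symm y ∈ Y) (hs : ∀ x, ∀ y ∈ Y, S.sigma x y ∈ Y) :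
    Set.MapsTo S.r (Y ×ˢ Y) (Y ×ˢ Y) := by
  rintro ⟨u, v⟩ ⟨hu, hv⟩
  refine ⟨hl u v hv, ?_⟩
  change S.rho v u ∈ Y
  have := hl' (S.lam u v) _ (hs (S.lam u v) u hu)
  rwa [sigma_lam, Equiv.symm_apply_apply] at this

/-- A solution whose permutation group is intransitive is decomposable. -/
theorem isDecomposable_of_not_transitive [Finite X] {x y : X}
    (h : ∀ g ∈ S.permGroup, g x ≠ y) : S.IsDecomposable := by
  let Y : Set X := {z | ∃ g ∈ S.permGroup, g x = z}
  have hY : ∀ g ∈ S.permGroup, ∀ z, g z ∈ Y ↔ z ∈ Y := by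
    intro g hg z
    constructor
    · rintro ⟨k, hk, e⟩
      exact ⟨g⁻¹ * k, mul_mem (inv_mem hg) hk, by rw [Equiv.Perm.mul_apply, e]; simp⟩
    · rintro ⟨k, hk, rfl⟩
      exact ⟨g * k, mul_mem hg hk, rfl⟩
  have hl : ∀ u, S.lam u ∈ S.permGroup := fun u => Subgroup.subset_closure (Or.inl ⟨u, rfl⟩)
  have hs : ∀ u, S.sigmaPerm u ∈ S.permGroup := fun u => Subgroup.subset_closure (Or.inr ⟨u, rfl⟩)
  refine ⟨Y, Yᶜ, ⟨x, 1, one_mem _, rfl⟩, ⟨y, fun ⟨g, hg, e⟩ => h g hg e⟩, disjoint_compl_right,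
    Set.union_compl_self Y, ?_, ?_⟩
  · exact S.mapsTo_r_of_invariant (fun u z hz => (hY _ (hl u) z).2 hz)
      (fun u z hz => (hY _ (inv_mem (hl u)) z).2 hz) (fun u z hz => (hY _ (hs u) z).2 hz)
  · exact S.mapsTo_r_of_invariant (fun u z hz => mt (hY _ (hl u) z).1 hz)
      (fun u z hz => mt (hY _ (inv_mem (hl u)) z).1 hz) (fun u z hz => mt (hY _ (hs u) z).1 hz)

/-- An equivariant image of a finite set with a transitive group of permutations has cardinality
dividing that of the set. -/
lemma _root_.Set.ncard_range_dvd_card_of_transitive {X B : Type*} [Finite X] [Nonempty X]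
    (f : X → B) (h : ∀ x y, ∃ (g : Equiv.Perm X) (ψ : Equiv.Perm B),
      g x = y ∧ ∀ u, f (g u) = ψ (f u)) : (Set.range f).ncard ∣ Nat.card X := by
  classical
  obtain ⟨x₀⟩ := ‹Nonempty X›
  have hfib : ∀ b : Set.range f, Nat.card {x // Set.rangeFactorization f x = b} =
      Nat.card {x // f x = f x₀} := by
    rintro ⟨_, y, rfl⟩
    obtain ⟨g, ψ, rfl, hg⟩ := h x₀ y
    refine Nat.card_congr (g.subtypeEquiv fun u => ?_).symm
    rw [Subtype.ext_iff]
    change _ ↔ f (g u) = f (g x₀)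
    rw [hg, hg, ψ.apply_eq_iff_eq]
  have := Fintype.ofFinite (Set.range f)
  rw [Nat.card_congr (Equiv.sigmaFiberEquiv (Set.rangeFactorization f)).symm, Nat.card_sigma,
    Finset.sum_congr rfl fun b _ => hfib b, Finset.sum_const, smul_eq_mul, Finset.card_univ,
    ← Nat.card_eq_fintype_card]
  exact Dvd.intro _ rfl

lemma gen_sigma (y x : X) : S.gen (S.sigma y x) = (S.gen y)⁻¹ * S.gen x * S.gen y := by
  rw [mul_assoc, gen_mul_gen, inv_mul_cancel_left]

/-- If all generators coincide, the derived group is infinite cyclic. -/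
lemma nonempty_mulEquiv_int [Nonempty X] (h : ∀ x y, S.gen x = S.gen y) :
    Nonempty (S.DerivedGroup ≃* Multiplicative ℤ) := by
  obtain ⟨x₀⟩ := ‹Nonempty X›
  let f : S.DerivedGroup →* Multiplicative ℤ :=
    S.liftGen (fun _ => Multiplicative.ofAdd 1) fun _ _ => rfl
  refine ⟨f.toMulEquiv (zpowersHom _ (S.gen x₀)) (S.hom_ext fun x => ?_) ?_⟩
  · simp [f, h x x₀]
  · ext; simp [f]

variable [Finite X]

/-- The rack automorphism attached to an element of the derived group. -/
noncomputable def act (d : S.DerivedGroup) : S.rackAut := (S.rightAction d).unop 1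

lemma rightAction_apply (g : S.rackAut) (d : S.DerivedGroup) :
    (S.rightAction (S.aut g d)).unop g = g * S.act d := by
  rw [rightAction_aut]
  change g * (S.rightAction d).unop (g⁻¹ * g) = _
  rw [inv_mul_cancel]; rfl

/-- The skew brace law. It holds because the right action commutes with left translations up to the
twist by `aut`. -/
lemma act_mul (d e : S.DerivedGroup) : S.act (d * S.aut (S.act d) e) = S.act d * S.act e := by
  rw [← rightAction_apply, act, map_mul]; rfl

lemma act_gen (x : X) : S.act (S.gen x) = S.lamAut x := by
  rw [act, rightAction_gen]
  change S.step x 1 = _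
  rw [step_apply, one_mul]; rfl

lemma act_one : S.act 1 = 1 := by
  rw [act, MonoidHom.map_one]; rfl

/-- As x = λ_x(q(x)), the power x^(k+1) is x · λ_x(q(x)^k), and `act_mul` gives the recursion. For k
= |q| it follows that x^k fixes x. -/
lemma act_gen_pow (k : ℕ) : ∀ x, (S.act (S.gen x ^ k)).1⁻¹ x = (S.diagonal ^ k) x := by
  induction k with
  | zero => intro x; rw [pow_zero, act_one, pow_zero]; rfl
  | succ k ih =>
    intro x
    have h1 : S.gen x ^ (k + 1) =
        S.gen x * S.aut (S.act (S.gen x)) (S.gen (S.diagonal x) ^ k) := by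
      rw [map_pow, act_gen, aut_gen, pow_succ']
      congr 3
      exact (S.lam_diagonal x).symm
    rw [h1, act_mul, act_gen, pow_succ]
    change ((S.lam x) * (S.act (S.gen (S.diagonal x) ^ k)).1)⁻¹ x =
      (S.diagonal ^ k) (S.diagonal x)
    rw [mul_inv_rev, ← ih]; rfl

/-- The finite quotient of the derived group. -/
abbrev FiniteDerived : Type _ := S.DerivedGroup ⧸ S.socle

/-- The image of a generator in the finite quotient. -/
noncomputable def fgen (x : X) : S.FiniteDerived := QuotientGroup.mk (S.gen x)

/-- The action of rack automorphisms on the finite quotient. -/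
noncomputable def faut : S.rackAut →* MulAut S.FiniteDerived where
  toFun g := QuotientGroup.congr S.socle S.socle (S.aut g) (S.socle_map_aut g)
  map_one' := by
    ext ⟨d⟩
    change QuotientGroup.mk (S.aut 1 d) = _
    rw [map_one]; rfl
  map_mul' g h := by
    ext ⟨d⟩
    change QuotientGroup.mk (S.aut (g * h) d) = QuotientGroup.mk (S.aut g (S.aut h d))
    rw [map_mul]; rfl

lemma faut_mk (g : S.rackAut) (d : S.DerivedGroup) :
    S.faut g (QuotientGroup.mk d) = QuotientGroup.mk (S.aut g d) := rfl

lemma faut_fgen (g : S.rackAut) (x : X) : S.faut g (S.fgen x) = S.fgen (g.1 x) := by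
  rw [fgen, faut_mk, aut_gen]; rfl

/-- The rack automorphism attached to an element of the finite quotient. -/
noncomputable def fact (a : S.FiniteDerived) : S.rackAut :=
  (QuotientGroup.lift S.socle S.rightAction (fun _ h => (Subgroup.mem_inf.1 h).1) a).unop 1

lemma fact_mk (d : S.DerivedGroup) : S.fact (QuotientGroup.mk d) = S.act d := rfl

lemma fact_mul (a b : S.FiniteDerived) : S.fact (a * S.faut (S.fact a) b) = S.fact a * S.fact b := by
  obtain ⟨d, rfl⟩ := QuotientGroup.mk_surjective a
  obtain ⟨e, rfl⟩ := QuotientGroup.mk_surjective b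
  rw [fact_mk, faut_mk, ← QuotientGroup.mk_mul, fact_mk, act_mul, fact_mk]

lemma fact_one : S.fact 1 = 1 := S.act_one

/-- The graph of `fact`, a finite quotient of the structure group of the solution. -/
noncomputable def structureGroup : Subgroup (S.FiniteDerived ⋊[S.faut] S.rackAut) where
  carrier := {γ | γ.right = S.fact γ.left}
  mul_mem' := fun {γ δ} hγ hδ => by
    change γ.right * δ.right = S.fact (γ.left * S.faut γ.right δ.left)
    rw [show γ.right = _ from hγ, show δ.right = _ from hδ, fact_mul]
  one_mem' := S.fact_one.symm
  inv_mem' := fun {γ} hγ => by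
    change γ.right⁻¹ = S.fact (S.faut γ.right⁻¹ γ.left⁻¹)
    have h1 := S.fact_mul γ.left (S.faut γ.right⁻¹ γ.left⁻¹)
    have h2 : S.faut γ.right (S.faut γ.right⁻¹ γ.left⁻¹) = γ.left⁻¹ := by
      rw [map_inv S.faut, MulAut.apply_inv_self]
    rw [← show γ.right = _ from hγ, h2, mul_inv_cancel, fact_one] at h1
    exact inv_eq_of_mul_eq_one_right h1.symm

/-- The structure group acts on the finite quotient of the derived group. -/
noncomputable def structureGroupAut : S.structureGroup →* MulAut S.FiniteDerived :=
  S.faut.comp (SemidirectProduct.rightHom.comp S.structureGroup.subtype)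

/-- The bijective cocycle from the structure group to the derived group. -/
noncomputable def cocycle : S.structureGroup ≃ S.FiniteDerived where
  toFun γ := γ.1.left
  invFun a := ⟨⟨a, S.fact a⟩, rfl⟩
  left_inv γ := Subtype.ext (SemidirectProduct.ext rfl γ.2.symm)
  right_inv _ := rfl

lemma cocycle_mul (γ δ : S.structureGroup) :
    S.cocycle (γ * δ) = S.cocycle γ * S.structureGroupAut γ (S.cocycle δ) := rfl

lemma structureGroupAut_symm (a : S.FiniteDerived) :
    S.structureGroupAut (S.cocycle.symm a) = S.faut (S.fact a) := rfl

instance : Finite S.structureGroup := Finite.of_equiv _ S.cocycle.symm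

/-- Permutations in `permGroup` are induced by `A ⋊ G`. -/
lemma exists_semidirectConj {h : Equiv.Perm X} (hh : h ∈ S.permGroup) :
    ∃ γ, ∀ u, S.fgen (h u) = semidirectConj S.structureGroupAut γ (S.fgen u) := by
  induction hh using Subgroup.closure_induction with
  | mem h hh =>
    rcases hh with ⟨x, rfl⟩ | ⟨y, rfl⟩
    · refine ⟨SemidirectProduct.inr (S.cocycle.symm (S.fgen x)), fun u => ?_⟩
      rw [semidirectConj_apply]
      simp only [SemidirectProduct.left_inr, SemidirectProduct.right_inr, one_mul, inv_one, mul_one]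
      rw [structureGroupAut_symm]
      change _ = S.faut (S.act (S.gen x)) (S.fgen u)
      rw [act_gen, faut_fgen]; rfl
    · refine ⟨SemidirectProduct.inl (S.fgen y)⁻¹, fun u => ?_⟩
      rw [semidirectConj_apply]
      simp only [SemidirectProduct.left_inl, SemidirectProduct.right_inl, map_one,
        MulAut.one_apply, inv_inv]
      exact congrArg QuotientGroup.mk (S.gen_sigma y u)
  | one => exact ⟨1, fun u => by rw [map_one]; rfl⟩
  | mul a b _ _ ha hb =>
    obtain ⟨γ, hγ⟩ := ha
    obtain ⟨δ, hδ⟩ := hb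
    exact ⟨γ * δ, fun u => by rw [Equiv.Perm.mul_apply, hγ, hδ, map_mul]; rfl⟩
  | inv a _ ha =>
    obtain ⟨γ, hγ⟩ := ha
    refine ⟨γ⁻¹, fun u => ?_⟩
    rw [map_inv, ← MulEquiv.symm_apply_eq, MulAut.inv_symm]
    rw [← hγ]; simp

lemma closure_range_fgen : Subgroup.closure (Set.range S.fgen) = ⊤ := by
  have h := S.closure_range_gen
  have h1 := congrArg (Subgroup.map (QuotientGroup.mk' S.socle)) h
  rw [MonoidHom.map_closure, Subgroup.map_top_of_surjective _ (QuotientGroup.mk'_surjective _),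
    ← Set.range_comp] at h1
  exact h1

/-- If the permutation group is transitive, all generators agree modulo the socle. -/
theorem fgen_eq_fgen [Nonempty X] (hnil : Group.IsNilpotent S.DerivedGroup)
    (htr : ∀ x y, ∃ g ∈ S.permGroup, g x = y)
    (hq : Nat.gcd (Nat.card X) (orderOf S.diagonal) = 1) (x y : X) : S.fgen x = S.fgen y := by
  have hdvd : (Set.range S.fgen).ncard ∣ Nat.card X := by
    refine Set.ncard_range_dvd_card_of_transitive S.fgen fun x y => ?_
    obtain ⟨g, hg, e⟩ := htr x y
    obtain ⟨γ, hγ⟩ := S.exists_semidirectConj hg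
    exact ⟨g, (semidirectConj S.structureGroupAut γ).toEquiv, e, hγ⟩
  have hk : S.diagonal ^ orderOf S.diagonal = 1 := pow_orderOf_eq_one _
  refine subsingleton_of_bijective_cocycle (φ := S.structureGroupAut) (c := S.cocycle)
    (k := orderOf S.diagonal) inferInstance S.cocycle_mul S.closure_range_fgen ?_ ?_ ?_ ?_
    (Nat.Coprime.coprime_dvd_left hdvd hq) ⟨x, rfl⟩ ⟨y, rfl⟩
  · rintro g _ ⟨x, rfl⟩
    exact ⟨_, (S.faut_fgen _ x).symm⟩
  · rintro a _ ⟨x, rfl⟩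
    obtain ⟨d, rfl⟩ := QuotientGroup.mk_surjective a
    obtain ⟨z, hz⟩ := S.conj_gen_mem d x
    exact ⟨z, congrArg QuotientGroup.mk hz⟩
  · rintro _ ⟨x, rfl⟩ _ ⟨y, rfl⟩
    obtain ⟨g, hg, rfl⟩ := htr x y
    obtain ⟨γ, hγ⟩ := S.exists_semidirectConj hg
    exact ⟨γ, (hγ x).symm⟩
  · rintro _ ⟨x, rfl⟩
    rw [structureGroupAut_symm]
    have h1 := S.act_gen_pow (orderOf S.diagonal) x
    rw [hk] at h1
    have h2 : (S.act (S.gen x ^ orderOf S.diagonal)).1 x = x := by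
      rw [Equiv.Perm.inv_eq_iff_eq] at h1
      exact h1.symm
    change S.faut (S.act (S.gen x ^ orderOf S.diagonal)) (S.fgen x) = S.fgen x
    rw [faut_fgen, h2]

/-- If the permutation group is transitive, all generators agree. -/
theorem gen_eq_gen [Nonempty X] (hnil : Group.IsNilpotent S.DerivedGroup)
    (htr : ∀ x y, ∃ g ∈ S.permGroup, g x = y)
    (hq : Nat.gcd (Nat.card X) (orderOf S.diagonal) = 1) (x y : X) : S.gen x = S.gen y := by
  obtain ⟨x₀⟩ := ‹Nonempty X›
  have hf := S.fgen_eq_fgen hnil htr hq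
  -- `act` factors through the finite quotient, where all generators agree; the central part of the
  -- socle makes the generators commute.
  have hlam : ∀ x, S.lamAut x = S.lamAut x₀ := fun x => by
    rw [← act_gen, ← act_gen, ← fact_mk, ← fact_mk]; exact congrArg S.fact (hf x x₀)
  have hcomm : ∀ x y, S.gen (S.sigma y x) = S.gen x := fun x y => by
    have h1 : (S.gen x)⁻¹ * S.gen y ∈ S.socle := QuotientGroup.eq.1 (hf x y)
    have h2 := Subgroup.mem_center_iff.1 (Subgroup.mem_inf.1 h1).2 (S.gen x)
    have h3 : S.gen x * S.gen y = S.gen y * S.gen x := by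
      rw [mul_inv_cancel_left] at h2
      conv_lhs => rw [h2]
      group
    rw [gen_sigma, mul_assoc, h3, inv_mul_cancel_left]
  set L := S.lamAut x₀ with hL
  -- On the generators each σ acts trivially and each λ acts as L, so the transitive group acts
  -- through powers of L; and q = L⁻¹ bounds the order of that cyclic action.
  have hperm : ∀ g ∈ S.permGroup, ∃ n : ℤ, ∀ u, S.gen (g u) = S.aut (L ^ n) (S.gen u) := by
    intro g hg
    induction hg using Subgroup.closure_induction with
    | mem g hg =>
      rcases hg with ⟨x, rfl⟩ | ⟨y, rfl⟩
      · exact ⟨1, fun u => by rw [zpow_one, ← hlam x, aut_gen]; rfl⟩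
      · exact ⟨0, fun u => by rw [zpow_zero, map_one]; exact hcomm u y⟩
    | one => exact ⟨0, fun u => by rw [zpow_zero, map_one]; rfl⟩
    | mul a b _ _ ha hb =>
      obtain ⟨m, hm⟩ := ha
      obtain ⟨n, hn⟩ := hb
      exact ⟨m + n, fun u => by rw [Equiv.Perm.mul_apply, hm, hn, zpow_add, map_mul]; rfl⟩
    | inv a _ ha =>
      obtain ⟨n, hn⟩ := ha
      refine ⟨-n, fun u => ?_⟩
      have h1 := hn (a⁻¹ u)
      rw [show a (a⁻¹ u) = u from a.apply_symm_apply u] at h1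
      rw [h1, zpow_neg, map_inv, MulAut.inv_apply_self]
  have hord : S.aut L ^ orderOf S.diagonal = 1 := by
    have h1 : S.diagonal = fun u => (S.lam x₀).symm u := by
      funext u
      change (S.lam u).symm u = _
      rw [show S.lam u = S.lam x₀ from congrArg Subtype.val (hlam u)]
    have h2 : ∀ k : ℕ, ∀ u, (S.diagonal ^ k) u = ((L ^ k)⁻¹).1 u := by
      intro k
      induction k with
      | zero => intro u; simp; rfl
      | succ k ih =>
        intro u
        rw [pow_succ, pow_succ', mul_inv_rev]
        change (S.diagonal ^ k) (S.diagonal u) = ((L ^ k)⁻¹).1 ((S.lam x₀).symm u)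
        rw [ih, h1]
    have h3 : (L ^ orderOf S.diagonal)⁻¹ = 1 := by
      apply Subtype.ext; ext u
      rw [← h2, pow_orderOf_eq_one]; rfl
    rw [← map_pow, inv_eq_one.1 h3, map_one]
  have hdvd1 : (Set.range S.gen).ncard ∣ Nat.card X := by
    have : Nonempty X := ⟨x₀⟩
    refine Set.ncard_range_dvd_card_of_transitive S.gen fun x y => ?_
    obtain ⟨g, hg, e⟩ := htr x y
    obtain ⟨n, hn⟩ := hperm g hg
    exact ⟨g, (S.aut (L ^ n)).toEquiv, e, hn⟩
  have hdvd2 : (Set.range S.gen).ncard ∣ orderOf S.diagonal := by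
    have h1 : MulAction.orbit (Subgroup.zpowers (S.aut L)) (S.gen x₀) = Set.range S.gen := by
      ext d
      constructor
      · rintro ⟨⟨_, n, rfl⟩, rfl⟩
        change (S.aut L ^ n) (S.gen x₀) ∈ _
        rw [← map_zpow, aut_gen]
        exact ⟨_, rfl⟩
      · rintro ⟨x, rfl⟩
        obtain ⟨g, hg, rfl⟩ := htr x₀ x
        obtain ⟨n, hn⟩ := hperm g hg
        refine ⟨⟨_, n, rfl⟩, ?_⟩
        change (S.aut L ^ n) (S.gen x₀) = _
        rw [hn, map_zpow]
    rw [← h1, ← MulAction.index_stabilizer]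
    refine (Subgroup.index_dvd_card _).trans ?_
    rw [Nat.card_zpowers]
    exact orderOf_dvd_of_pow_eq_one hord
  have h1 : (Set.range S.gen).ncard = 1 := Nat.dvd_one.1 (hq ▸ Nat.dvd_gcd hdvd1 hdvd2)
  obtain ⟨d, hd⟩ := Set.ncard_eq_one.1 h1
  have hx : ∀ x, S.gen x = d := fun x => by
    have : S.gen x ∈ Set.range S.gen := ⟨x, rfl⟩
    rwa [hd] at this
  rw [hx, hx]

end YBSolution

theorem mainTheorem9 {X : Type*} [Finite X] [Nonempty X] (S : YBSolution X)
    (hnil : Group.IsNilpotent S.DerivedGroup)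
    (hZ : IsEmpty (S.DerivedGroup ≃* Multiplicative ℤ))
    (hq : Nat.gcd (Nat.card X) (orderOf S.diagonal) = 1) :
    S.IsDecomposable := by
  by_contra hdec
  refine (not_nonempty_iff.2 hZ) (S.nonempty_mulEquiv_int (S.gen_eq_gen hnil (fun x y => ?_) hq))
  by_contra! h
  exact hdec (S.isDecomposable_of_not_transitive h)
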